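/- Let $l\ge 1$ and let $D_0\in M(l,\mathbb R)$ be symmetric and invertible. There are constants $k_1,k_2>0$, depending only on $l$ and $D_0$, with the following property. Let $(D_n)_{n\ge 0}$ (starting with the given $D_0$) and $(V_n)_{n\ge 0}$ be sequences of real symmetric $l\times l$ matrices, every $D_n$ invertible ($V_0$ plays no role), and for a sequence $\mathbf u=(\mathbf u_n)_{n\ge 0}$ in $\mathbb C^l$ put $$(H\mathbf u)_n = D_{n-1}\mathbf u_{n-1}+D_n\mathbf u_{n+1}+V_n\mathbf u_n,\qquad n\ge 1 .$$ Assume the boundary condition at $+\infty$: for all square summable $\mathbf u,\mathbf v$ such that $H\mathbf u$, $H\mathbf v$ are square summable, $$\lim_{n\to\infty}\big(\mathbf v_n^{t}D_n\mathbf u_{n+1}-\mathbf v_{n+1}^{t}D_n\mathbf u_n\big)=0$$ (this holds, for instance, if $(D_n)$ is bounded). Let $H^\phi_+$ be the Dirichlet operator, that is, $\mathbf u\mapsto H\mathbf u$ on the domain of all square summable $\mathbf u$ with $\mathbf u_0=0$ and $H\mathbf u$ square summable, in the Hilbert space $\ell^2(\{1,2,\dots\};\mathbb C^l)$; let $E$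 be its resolution of the identity, $\mu_{\mathbf u,\mathbf v}(\cdot)=\langle \mathbf u,E(\cdot)\mathbf v\rangle$, and let $$[M^\phi(z)]_{jk}=\int\frac{1}{t-z}\,d\mu_{\mathbf e_{1,j},\mathbf e_{1,k}}(t),\qquad 1\le j,k\le l,\ z\in\mathbb C\setminus\mathbb R,$$ where $\mathbf e_{1,j}$ is the $j$-th canonical vector of $\mathbb C^l$ placed at the site $1$. Let $x\in\mathbb R$, $y>0$, and let $\phi=(\phi_n)$, $\psi=(\psi_n)$ be the $l\times l$ matrix solutions of $D_{n-1}U_{n-1}+D_nU_{n+1}+V_nU_n=xU_n$, $n\ge 1$, with $\phi_0=0$, $\phi_1=I$ and $\psi_0=I$, $\psi_1=0$. Let $\|\cdot\|$ be the Frobenius norm and $s_1[A]\ge\dots\ge s_l[A]$ the singular values of a matrix $A$. For real $L\ge1$ and a sequence $B=(B_n)$ of matrices put $$\|B\|_L^2=\sum_{n=1}^{\lfloor L\rfloor}\|B_n\|^2+(L-\lfloor L\rfloor)\|B_{\lfloor L\rfloor+1}\|^2,\qquad s_l[B]_L^2=\sum_{n=1}^{\lfloor L\rfloor}s_l[B_n]^2+(L-\lfloor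 L\rfloor)\,s_l[B_{\lfloor L\rfloor+1}]^2 .$$ Then there is $L=L(y)\ge 1$ with $$2y\,\|D_0^{-1}\|\,\|\psi\|_{L}\,\|\phi\|_{L}=1,$$ and for every such $L$ one has $\|\phi\|_L\neq0$, $s_l[\phi]_L\ne 0$ and $$k_1\frac{\|\psi\|_{L}}{\|\phi\|_{L}}\le\|M^\phi(x+iy)\|\le k_2\,\frac{\|\psi\|_{L}}{\|\phi\|_{L}}\cdot\frac{\|\phi\|_{L}^2}{s_l[\phi]_{L}^2}.$$ -/

import Mathlib

open MeasureTheory Filter Topology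
open scoped InnerProductSpace

/- `‖A‖` for a matrix `A` is the Frobenius norm. -/
attribute [local instance] Matrix.frobeniusNormedAddCommGroup

noncomputable section

namespace MatrixJacobi

/-! ### Resolutions of the identity and spectral measures -/

section Spectral

variable {K : Type*} [NormedAddCommGroup K] [InnerProductSpace ℂ K] [CompleteSpace K]

/-- A resolution of the identity (projection-valued Borel measure on `ℝ`) in a Hilbert space:
`E B` is an orthogonal projection for each Borel set `B`, `E ∅ = 0`, `E ℝ = 1`,
`E (A ∩ B) = E A E B`, and `E` is strongly countably additive.
The values on non-measurable sets are irrelevant. -/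
structure ResolutionOfIdentity (K : Type*) [NormedAddCommGroup K] [InnerProductSpace ℂ K]
    [CompleteSpace K] where
  proj : Set ℝ → K →L[ℂ] K
  isStarProjection : ∀ B, MeasurableSet B → IsStarProjection (proj B)
  empty : proj ∅ = 0
  univ : proj Set.univ = 1
  inter : ∀ A B, MeasurableSet A → MeasurableSet B → proj (A ∩ B) = proj A * proj B
  iUnion : ∀ f : ℕ → Set ℝ, (∀ i, MeasurableSet (f i)) → Pairwise (Function.onFun Disjoint f) →
    ∀ u : K, HasSum (fun i => proj (f i) u) (proj (⋃ i, f i) u)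

namespace ResolutionOfIdentity

open Classical in
/-- The complex spectral measure `μ_{u,v}(B) = ⟨u, E(B) v⟩`. -/
def complexMeasure (E : ResolutionOfIdentity K) (u v : K) : ComplexMeasure ℝ where
  measureOf' B := if MeasurableSet B then ⟪u, E.proj B v⟫_ℂ else 0
  empty' := by simp [E.empty]
  not_measurable' B hB := by simp [hB]
  m_iUnion' f hf hd := by
    simp only [hf, MeasurableSet.iUnion hf, if_true]
    exact (E.iUnion f hf hd v).mapL (innerSL ℂ u)

theorem re_inner_nonneg (E : ResolutionOfIdentity K) (u : K) {B : Set ℝ} (hB : MeasurableSet B) :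
    0 ≤ (⟪u, E.proj B u⟫_ℂ).re := by
  have h := E.isStarProjection B hB
  have h1 : E.proj B (E.proj B u) = E.proj B u := congrArg (fun T => T u) h.isIdempotentElem
  have h2 : ⟪E.proj B u, E.proj B u⟫_ℂ = ⟪u, E.proj B (E.proj B u)⟫_ℂ := by
    have h3 := ContinuousLinearMap.adjoint_inner_left (E.proj B) (E.proj B u) u
    rwa [← ContinuousLinearMap.star_eq_adjoint, h.isSelfAdjoint.star_eq] at h3
  rw [h1] at h2
  rw [← h2]
  exact inner_self_nonneg (𝕜 := ℂ)

/-- The positive spectral measure `μ_u(B) = ⟨u, E(B) u⟩`. -/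
def measure (E : ResolutionOfIdentity K) (u : K) : Measure ℝ :=
  Measure.ofMeasurable (fun B _ => ENNReal.ofReal (⟪u, E.proj B u⟫_ℂ).re)
    (by simp [E.empty])
    (by
      intro f hf hd
      have h : HasSum (fun i => (⟪u, E.proj (f i) u⟫_ℂ).re)
          (⟪u, E.proj (⋃ i, f i) u⟫_ℂ).re :=
        ((E.iUnion f hf hd u).mapL (innerSL ℂ u)).mapL Complex.reCLM
      rw [← h.tsum_eq, ENNReal.ofReal_tsum_of_nonneg
        (fun i => E.re_inner_nonneg u (hf i)) h.summable])

/-- `E` is the resolution of the identity of the operator `H`, that is, `H = ∫ t dE(t)`: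
the domain of `H` is `{u | ∫ t² dμ_u(t) < ∞}`, and `⟨u, H u⟩ = ∫ t dμ_u(t)` there. -/
def IsResolutionOf (E : ResolutionOfIdentity K) (H : K →ₗ.[ℂ] K) : Prop :=
  (∀ u : K, u ∈ H.domain ↔ Integrable (fun t : ℝ => t ^ 2) (E.measure u)) ∧
    ∀ u : H.domain, ⟪(u : K), H u⟫_ℂ = ((∫ t, t ∂(E.measure (u : K)) : ℝ) : ℂ)

end ResolutionOfIdentity

end Spectral

/-! ### The matrix Jacobi operator on the half-line -/

variable {l : ℕ}

/-- A real matrix regarded as a complex one. -/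
def toComplex (A : Matrix (Fin l) (Fin l) ℝ) : Matrix (Fin l) (Fin l) ℂ := A.map Complex.ofReal

/-- For a sequence `u` of vectors at the sites `0, 1, 2, …`, the vector
`D_n u_n + D_{n+1} u_{n+2} + V_{n+1} u_{n+1}`, which is the value of `H u` at the site `n + 1`. -/
def jacobi (D V : ℕ → Matrix (Fin l) (Fin l) ℝ) (u : ℕ → EuclideanSpace ℂ (Fin l)) (n : ℕ) :
    EuclideanSpace ℂ (Fin l) :=
  Matrix.toEuclideanLin (toComplex (D n)) (u n)
    + Matrix.toEuclideanLin (toComplex (D (n + 1))) (u (n + 2))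
    + Matrix.toEuclideanLin (toComplex (V (n + 1))) (u (n + 1))

/-- The domain of the maximal half-line operator: square summable sequences `u` at the sites
`0, 1, 2, …` for which `H u` is square summable. -/
def MemMaxDomain (D V : ℕ → Matrix (Fin l) (Fin l) ℝ) (u : ℕ → EuclideanSpace ℂ (Fin l)) : Prop :=
  Memℓp u 2 ∧ Memℓp (jacobi D V u) 2

/-- The boundary condition at `+∞`: for all `u, v` in the maximal domain, the (bilinear)
boundary form `⟨v_n, D_n u_{n+1}⟩ - ⟨v_{n+1}, D_n u_n⟩` tends to `0`. -/
def BoundaryFormVanishes (D V : ℕ → Matrix (Fin l) (Fin l) ℝ) : Prop :=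
  ∀ u v : ℕ → EuclideanSpace ℂ (Fin l), MemMaxDomain D V u → MemMaxDomain D V v →
    Tendsto (fun n => (v n).ofLp ⬝ᵥ (toComplex (D n)).mulVec (u (n + 1)).ofLp
      - (v (n + 1)).ofLp ⬝ᵥ (toComplex (D n)).mulVec (u n).ofLp) atTop (𝓝 0)

/-- The Hilbert space of square summable sequences at the sites `1, 2, 3, …`, that is, of the
`u` in `ℓ²` with `u_0 = 0`. The coordinate with index `n : ℕ` is the value at the site `n + 1`. -/
abbrev HalfLine (l : ℕ) := lp (fun _ : ℕ => EuclideanSpace ℂ (Fin l)) 2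

/-- The sequence at the sites `0, 1, 2, …` given by an element of `HalfLine l`, with `u_0 = 0`. -/
def dirichletExt (u : ℕ → EuclideanSpace ℂ (Fin l)) : ℕ → EuclideanSpace ℂ (Fin l)
  | 0 => 0
  | n + 1 => u n

theorem dirichletExt_add (u v : ℕ → EuclideanSpace ℂ (Fin l)) :
    dirichletExt (u + v) = dirichletExt u + dirichletExt v := by
  funext n; cases n <;> simp [dirichletExt]

theorem dirichletExt_smul (c : ℂ) (u : ℕ → EuclideanSpace ℂ (Fin l)) :
    dirichletExt (c • u) = c • dirichletExt u := by
  funext n; cases n <;> simp [dirichletExt]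

theorem jacobi_add (D V : ℕ → Matrix (Fin l) (Fin l) ℝ) (u v : ℕ → EuclideanSpace ℂ (Fin l)) :
    jacobi D V (u + v) = jacobi D V u + jacobi D V v := by
  funext n; simp only [jacobi, Pi.add_apply, map_add]; abel

theorem jacobi_smul (D V : ℕ → Matrix (Fin l) (Fin l) ℝ) (c : ℂ)
    (u : ℕ → EuclideanSpace ℂ (Fin l)) : jacobi D V (c • u) = c • jacobi D V u := by
  funext n; simp only [jacobi, Pi.smul_apply, map_smul, smul_add]

/-- The domain `{u ∈ ℓ² | H u ∈ ℓ², u_0 = 0}` of the Dirichlet operator. -/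
def dirichletDomain (D V : ℕ → Matrix (Fin l) (Fin l) ℝ) : Submodule ℂ (HalfLine l) where
  carrier := {u | Memℓp (jacobi D V (dirichletExt u)) 2}
  add_mem' := by
    intro u v hu hv
    have h := Memℓp.add hu hv
    rw [← jacobi_add, ← dirichletExt_add] at h
    exact h
  zero_mem' := by
    have h : jacobi D V (dirichletExt (0 : ℕ → EuclideanSpace ℂ (Fin l))) = 0 := by
      funext n; cases n <;> simp [jacobi, dirichletExt]
    change Memℓp (jacobi D V (dirichletExt (0 : ℕ → EuclideanSpace ℂ (Fin l)))) 2
    rw [h]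
    exact zero_memℓp
  smul_mem' := by
    intro c u hu
    have h := Memℓp.const_smul hu c
    rw [← jacobi_smul, ← dirichletExt_smul] at h
    exact h

/-- The Dirichlet operator: `u ↦ H u` on `{u ∈ ℓ² | H u ∈ ℓ², u_0 = 0}`. -/
def dirichletOperator (D V : ℕ → Matrix (Fin l) (Fin l) ℝ) : HalfLine l →ₗ.[ℂ] HalfLine l where
  domain := dirichletDomain D V
  toFun :=
    { toFun := fun u => ⟨jacobi D V (dirichletExt (u : HalfLine l)), u.2⟩
      map_add' := by
        intro u v
        apply Subtype.ext
        change jacobi D V (dirichletExt (((u : HalfLine l) : ℕ → _) + (v : HalfLine l))) = _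
        rw [dirichletExt_add, jacobi_add]
        rfl
      map_smul' := by
        intro c u
        apply Subtype.ext
        change jacobi D V (dirichletExt (c • ((u : HalfLine l) : ℕ → _))) = _
        rw [dirichletExt_smul, jacobi_smul]
        rfl }

/-- The vector `e_{1,j}`: the `j`-th canonical vector of `ℂ^l` at the site `1`. -/
def siteOne (j : Fin l) : HalfLine l := lp.single 2 0 (EuclideanSpace.single j (1 : ℂ))

/-- The matrix-valued Weyl–Titchmarsh function, the Borel transform of the matrix-valued
spectral measure: `[M(z)]_{jk} = ∫ 1 / (t - z) dμ_{e_{1,j}, e_{1,k}}(t)`. -/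
def weylM (E : ResolutionOfIdentity (HalfLine l)) (z : ℂ) : Matrix (Fin l) (Fin l) ℂ :=
  Matrix.of fun j k =>
    ∫ᵛ t : ℝ, 1 / ((t : ℂ) - z) ∂[ContinuousLinearMap.mul ℝ ℂ; E.complexMeasure (siteOne j) (siteOne k)]

/-! ### Matrix solutions, truncated norms and truncated singular values -/

/-- The matrix solution at `z` of
`D_{n-1} U_{n-1} + D_n U_{n+1} + V_n U_n = z U_n`, `n ≥ 1`, with `U_0 = A`, `U_1 = B`. -/
def solution (D V : ℕ → Matrix (Fin l) (Fin l) ℝ) (z : ℂ) (A B : Matrix (Fin l) (Fin l) ℂ) :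
    ℕ → Matrix (Fin l) (Fin l) ℂ
  | 0 => A
  | 1 => B
  | n + 2 => (toComplex (D (n + 1)))⁻¹ *
      (z • solution D V z A B (n + 1) - toComplex (V (n + 1)) * solution D V z A B (n + 1)
        - toComplex (D n) * solution D V z A B n)

theorem solution_eq (D V : ℕ → Matrix (Fin l) (Fin l) ℝ) (hD : ∀ n, IsUnit (D n)) (z : ℂ)
    (A B : Matrix (Fin l) (Fin l) ℂ) (n : ℕ) :
    toComplex (D n) * solution D V z A B n
      + toComplex (D (n + 1)) * solution D V z A B (n + 2)
      + toComplex (V (n + 1)) * solution D V z A B (n + 1) = z • solution D V z A B (n + 1) := by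
  have h : IsUnit (toComplex (D (n + 1))) :=
    (hD (n + 1)).map (Complex.ofRealHom.mapMatrix (m := Fin l))
  rw [solution, ← mul_assoc, Matrix.mul_nonsing_inv _ ((Matrix.isUnit_iff_isUnit_det _).1 h),
    one_mul]
  abel

/-- The Dirichlet solution: `φ_0 = 0`, `φ_1 = 1`. -/
def phi (D V : ℕ → Matrix (Fin l) (Fin l) ℝ) (z : ℂ) : ℕ → Matrix (Fin l) (Fin l) ℂ :=
  solution D V z 0 1

/-- The Neumann solution: `ψ_0 = 1`, `ψ_1 = 0`. -/
def psi (D V : ℕ → Matrix (Fin l) (Fin l) ℝ) (z : ℂ) : ℕ → Matrix (Fin l) (Fin l) ℂ :=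
  solution D V z 1 0

/-- The `k`-th singular value `s_1 ≥ s_2 ≥ … ≥ s_l` of a matrix, `1 ≤ k ≤ l`. -/
def singularValue (k : ℕ) (A : Matrix (Fin l) (Fin l) ℂ) : ℝ :=
  (Matrix.toEuclideanLin A).singularValues (k - 1)

/-- The truncated norm `‖B‖_L`, for real `L ≥ 1`. -/
def truncNorm (B : ℕ → Matrix (Fin l) (Fin l) ℂ) (L : ℝ) : ℝ :=
  √(∑ n ∈ Finset.Icc 1 ⌊L⌋₊, ‖B n‖ ^ 2 + (L - ⌊L⌋₊) * ‖B (⌊L⌋₊ + 1)‖ ^ 2)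

/-- The truncated `k`-th singular value `s_k[B]_L`, for real `L ≥ 1`. -/
def truncSingularValue (k : ℕ) (B : ℕ → Matrix (Fin l) (Fin l) ℂ) (L : ℝ) : ℝ :=
  √(∑ n ∈ Finset.Icc 1 ⌊L⌋₊, singularValue k (B n) ^ 2
    + (L - ⌊L⌋₊) * singularValue k (B (⌊L⌋₊ + 1)) ^ 2)

/-- `L ≥ 1` solves `2 y ‖D₀⁻¹‖ ‖ψ‖_L ‖φ‖_L = 1`, where `φ`, `ψ` are the Dirichlet and Neumann
solutions at the real energy `x`. -/
def IsTruncationLength (D V : ℕ → Matrix (Fin l) (Fin l) ℝ) (x y L : ℝ) : Prop :=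
  1 ≤ L ∧ 2 * y * ‖(D 0)⁻¹‖ * truncNorm (psi D V x) L * truncNorm (phi D V x) L = 1

end MatrixJacobi

end

open MatrixJacobi

/-! The argument is of Jitomirskaya–Last type. Let z = x + iy and M = M^φ(z), and write a, b, s for
‖ψ‖_L, ‖φ‖_L, s_l[φ]_L. The resolvent of H at z applied to the vectors e_{1,k}, preceded by F_0 =
-D_0⁻¹, gives a square summable matrix solution F at energy z with F_1 = M (`exists_weyl_solution`).
The quadratic form of H is real, so y ∑ ‖F_n‖² over n ≥ 1 is controlled by the imaginary parts of
the diagonal of M, hence by l‖M‖.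

Let f_n = φ_n M - ψ_n D_0⁻¹ be the solution at the real energy x with the same initial values.
Variation of parameters (`variation_of_parameters`) writes f - F through φ and ψ with a factor z - x
= iy, and Cauchy–Schwarz bounds its truncated norm by 2y‖D_0⁻¹‖ab·p, where p = ‖F‖_L. The length L
is chosen to make this prefactor 1. Hence ‖f‖_L ≤ 2p (`truncL2_initial_combination_le`), while p² ≤
l‖M‖/y = 2l‖D_0⁻¹‖‖M‖ab. The triangle inequality for f gives a ≤ ‖D_0‖(2p + ‖M‖b) and s‖M‖ ≤ 2p +
‖D_0⁻¹‖a (`weylM_comparison`), and eliminating p yields the two bounds (`lower_bound_of_comparison`,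
`upper_bound_of_comparison`).

A length L exists because ‖ψ‖_L‖φ‖_L depends continuously on L, vanishes at L = 1 and is unbounded:
otherwise φ and ψ would both be square summable, and the boundary condition would force their
constant Wronskian D_0 to be 0.

The hypothesis on E supplies only the domain and the quadratic form of H. The resolvent is therefore
constructed as ∫ (t - z)⁻¹ dE by a bounded functional calculus (`IsResolutionOf.exists_resolvent`).
-/

namespace MatrixJacobi

/-! ### Bounded functional calculus for a resolution of the identity. -/

namespace ResolutionOfIdentity

variable {K : Type*} [NormedAddCommGroup K] [InnerProductSpace ℂ K] [CompleteSpace K]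
variable (E : ResolutionOfIdentity K)

theorem inner_proj_left {B : Set ℝ} (hB : MeasurableSet B) (u v : K) :
    ⟪E.proj B u, v⟫_ℂ = ⟪u, E.proj B v⟫_ℂ := by
  have h3 := ContinuousLinearMap.adjoint_inner_left (E.proj B) v u
  rwa [← ContinuousLinearMap.star_eq_adjoint, (E.isStarProjection B hB).isSelfAdjoint.star_eq] at h3

theorem proj_proj {A B : Set ℝ} (hA : MeasurableSet A) (hB : MeasurableSet B) (u : K) :
    E.proj A (E.proj B u) = E.proj (A ∩ B) u := by
  rw [E.inter A B hA hB]; rfl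

theorem inner_proj {B : Set ℝ} (hB : MeasurableSet B) (u v : K) :
    ⟪u, E.proj B v⟫_ℂ = ⟪E.proj B u, E.proj B v⟫_ℂ := by
  rw [E.inner_proj_left hB, E.proj_proj hB hB, Set.inter_self]

theorem re_inner_proj {B : Set ℝ} (hB : MeasurableSet B) (u : K) :
    (⟪u, E.proj B u⟫_ℂ).re = ‖E.proj B u‖ ^ 2 := by
  rw [E.inner_proj hB, inner_self_eq_norm_sq_to_K]
  norm_cast

theorem inner_proj_self {B : Set ℝ} (hB : MeasurableSet B) (u : K) :
    ⟪u, E.proj B u⟫_ℂ = ((‖E.proj B u‖ ^ 2 : ℝ) : ℂ) := by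
  rw [E.inner_proj hB, inner_self_eq_norm_sq_to_K]
  norm_cast

theorem measure_apply (u : K) {B : Set ℝ} (hB : MeasurableSet B) :
    E.measure u B = ENNReal.ofReal (‖E.proj B u‖ ^ 2) := by
  rw [← E.re_inner_proj hB]
  exact Measure.ofMeasurable_apply B hB

instance (u : K) : IsFiniteMeasure (E.measure u) :=
  ⟨by rw [E.measure_apply u MeasurableSet.univ]; exact ENNReal.ofReal_lt_top⟩

theorem complexMeasure_apply (u v : K) {B : Set ℝ} (hB : MeasurableSet B) :
    E.complexMeasure u v B = ⟪u, E.proj B v⟫_ℂ :=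
  if_pos hB

/-- Since E(B) is a projection, ⟨u, E(B)v⟩ = ⟨E(B)u, E(B)v⟩, and Cauchy–Schwarz with 2αβ ≤ α² + β²
applies. The resulting finite variation makes every bounded measurable function integrable. -/
theorem variation_complexMeasure_le (u v : K) :
    (E.complexMeasure u v).variation ≤ E.measure u + E.measure v := by
  refine VectorMeasure.variation_le_of_forall_enorm_le fun B hB => ?_
  rw [E.complexMeasure_apply u v hB, Measure.add_apply, E.measure_apply u hB,
    E.measure_apply v hB, ← ENNReal.ofReal_add (by positivity) (by positivity),
    ← ofReal_norm]
  refine ENNReal.ofReal_le_ofReal ?_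
  rw [E.inner_proj hB]
  have := norm_inner_le_norm (𝕜 := ℂ) (E.proj B u) (E.proj B v)
  nlinarith [sq_nonneg (‖E.proj B u‖ - ‖E.proj B v‖), norm_nonneg (E.proj B u),
    norm_nonneg (E.proj B v)]

instance (u v : K) : IsFiniteMeasure (E.complexMeasure u v).variation :=
  isFiniteMeasure_of_le _ (E.variation_complexMeasure_le u v)

theorem variation_complexMeasure_real_univ_le (u v : K) :
    (E.complexMeasure u v).variation.real Set.univ ≤ ‖u‖ ^ 2 + ‖v‖ ^ 2 := by
  have h := E.variation_complexMeasure_le u v Set.univ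
  rw [Measure.add_apply, E.measure_apply u .univ, E.measure_apply v .univ, E.univ,
    ← ENNReal.ofReal_add (by positivity) (by positivity)] at h
  exact ENNReal.toReal_le_of_le_ofReal (by positivity) h

theorem integrable_complexMeasure {g : ℝ → ℂ} (hg : Measurable g) {C : ℝ} (hC : ∀ t, ‖g t‖ ≤ C)
    (u v : K) : (E.complexMeasure u v).Integrable g :=
  Integrable.of_bound hg.aestronglyMeasurable C (ae_of_all _ hC)

/-- The bounded operator `T` is the weak integral `∫ g dE`. -/
def IsSpectralIntegral (g : ℝ → ℂ) (T : K →L[ℂ] K) : Prop :=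
  ∀ u v : K, ⟪u, T v⟫_ℂ =
    ∫ᵛ t : ℝ, g t ∂[ContinuousLinearMap.mul ℝ ℂ; E.complexMeasure u v]

variable {E}

theorem IsSpectralIntegral.unique {g : ℝ → ℂ} {S T : K →L[ℂ] K} (hS : E.IsSpectralIntegral g S)
    (hT : E.IsSpectralIntegral g T) : S = T := by
  ext v
  exact ext_inner_left ℂ fun u => (hS u v).trans (hT u v).symm

theorem IsSpectralIntegral.add {g h : ℝ → ℂ} {S T : K →L[ℂ] K} (hS : E.IsSpectralIntegral g S)
    (hT : E.IsSpectralIntegral h T) (hg : Measurable g) (hh : Measurable h) {C D : ℝ}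
    (hC : ∀ t, ‖g t‖ ≤ C) (hD : ∀ t, ‖h t‖ ≤ D) :
    E.IsSpectralIntegral (fun t => g t + h t) (S + T) := by
  intro u v
  rw [VectorMeasure.integral_fun_add (E.integrable_complexMeasure hg hC u v)
    (E.integrable_complexMeasure hh hD u v), ← hS, ← hT, ← inner_add_right]
  rfl

theorem IsSpectralIntegral.sub {g h : ℝ → ℂ} {S T : K →L[ℂ] K} (hS : E.IsSpectralIntegral g S)
    (hT : E.IsSpectralIntegral h T) (hg : Measurable g) (hh : Measurable h) {C D : ℝ}
    (hC : ∀ t, ‖g t‖ ≤ C) (hD : ∀ t, ‖h t‖ ≤ D) :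
    E.IsSpectralIntegral (fun t => g t - h t) (S - T) := by
  intro u v
  rw [VectorMeasure.integral_fun_sub (E.integrable_complexMeasure hg hC u v)
    (E.integrable_complexMeasure hh hD u v), ← hS, ← hT, ← inner_sub_right]
  rfl

theorem IsSpectralIntegral.const_mul {g : ℝ → ℂ} {T : K →L[ℂ] K} (hT : E.IsSpectralIntegral g T)
    (c : ℂ) : E.IsSpectralIntegral (fun t => c * g t) (c • T) := by
  intro u v
  have h : ∫ᵛ t : ℝ, c • g t ∂[ContinuousLinearMap.mul ℝ ℂ; E.complexMeasure u v] =
      c • ∫ᵛ t : ℝ, g t ∂[ContinuousLinearMap.mul ℝ ℂ; E.complexMeasure u v] := by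
    simp only [VectorMeasure.integral_eq_setToFun]
    exact setToFun_smul _ (fun c s x => mul_assoc c x _) c g
  simp only [smul_eq_mul] at h
  rw [h, ← hT, _root_.smul_apply, inner_smul_right]

/-- This is E(B)E(A) = E(B ∩ A) read on spectral measures, the germ of multiplicativity of the
calculus. -/
theorem complexMeasure_proj_left {B : Set ℝ} (hB : MeasurableSet B) (u v : K) :
    E.complexMeasure (E.proj B u) v = (E.complexMeasure u v).restrict B := by
  ext A hA
  rw [VectorMeasure.restrict_apply _ hB hA, E.complexMeasure_apply _ _ hA,
    E.complexMeasure_apply _ _ (hA.inter hB), E.inner_proj_left hB, E.proj_proj hB hA,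
    Set.inter_comm]

theorem IsSpectralIntegral.indicator {g : ℝ → ℂ} {T : K →L[ℂ] K} (hT : E.IsSpectralIntegral g T)
    {B : Set ℝ} (hB : MeasurableSet B) :
    E.IsSpectralIntegral (B.indicator g) (E.proj B * T) := by
  intro u v
  rw [VectorMeasure.integral_indicator hB, ← complexMeasure_proj_left hB, ← hT,
    E.inner_proj_left hB]
  rfl

theorem isSpectralIntegral_one : E.IsSpectralIntegral (fun _ => 1) 1 := by
  intro u v
  rw [VectorMeasure.integral_const, E.complexMeasure_apply _ _ .univ, E.univ]
  simp

theorem isSpectralIntegral_indicator_const {B : Set ℝ} (hB : MeasurableSet B) (c : ℂ) :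
    E.IsSpectralIntegral (B.indicator fun _ => c) (c • E.proj B) := by
  have h := ((isSpectralIntegral_one (E := E)).indicator hB).const_mul c
  rw [mul_one] at h
  convert h using 2 with t
  by_cases ht : t ∈ B <;> simp [ht]

/-- Test against the normalised vector `T v`. The factor 2 is the crude mass bound ‖u‖² + ‖v‖² for
unit vectors; it is harmless because the bound only serves to prove convergence. -/
theorem IsSpectralIntegral.norm_le {g : ℝ → ℂ} {T : K →L[ℂ] K} (hT : E.IsSpectralIntegral g T)
    {C : ℝ} (hC : ∀ t, ‖g t‖ ≤ C) : ‖T‖ ≤ 2 * C := by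
  have hC0 : 0 ≤ C := (norm_nonneg _).trans (hC 0)
  have key (u v : K) : ‖⟪u, T v⟫_ℂ‖ ≤ C * (‖u‖ ^ 2 + ‖v‖ ^ 2) := by
    rw [hT]
    refine (VectorMeasure.norm_integral_le_of_norm_le_const (ae_of_all _ hC)).trans ?_
    have := E.variation_complexMeasure_real_univ_le u v
    have h1 : ‖ContinuousLinearMap.mul ℝ ℂ‖ ≤ 1 := ContinuousLinearMap.opNorm_mul_le ℝ ℂ
    calc _ ≤ C * 1 * (‖u‖ ^ 2 + ‖v‖ ^ 2) := by gcongr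
      _ = _ := by ring
  refine ContinuousLinearMap.opNorm_le_of_unit_norm (by positivity) fun v hv => ?_
  by_cases h0 : T v = 0
  · rw [h0, norm_zero]; positivity
  have hn : (‖T v‖ : ℂ) ≠ 0 := by simpa using h0
  have h := key ((‖T v‖ : ℂ)⁻¹ • T v) v
  rw [inner_smul_left, inner_self_eq_norm_sq_to_K, norm_smul, hv, map_inv₀,
    Complex.conj_ofReal, norm_inv] at h
  have h2 : ‖T v‖ ≠ 0 := by simpa using h0
  simp only [Complex.norm_real, norm_norm] at h
  rw [inv_mul_cancel₀ h2, norm_mul, norm_inv] at h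
  norm_num at h
  rw [sq, inv_mul_cancel_left₀ h2] at h
  linarith

theorem IsSpectralIntegral.of_tendsto {g : ℝ → ℂ} {s : ℕ → ℝ → ℂ} {T : K →L[ℂ] K}
    {S : ℕ → K →L[ℂ] K} (hS : ∀ n, E.IsSpectralIntegral (s n) (S n)) (hs : ∀ n, Measurable (s n))
    {C : ℝ} (hC : ∀ n t, ‖s n t‖ ≤ C) (hg : ∀ t, Tendsto (fun n => s n t) atTop (𝓝 (g t)))
    (hT : Tendsto S atTop (𝓝 T)) : E.IsSpectralIntegral g T := by
  intro u v
  have h1 : Tendsto (fun n => ⟪u, S n v⟫_ℂ) atTop (𝓝 ⟪u, T v⟫_ℂ) :=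
    tendsto_const_nhds.inner (((ContinuousLinearMap.apply ℂ K v).continuous.tendsto T).comp hT)
  refine tendsto_nhds_unique h1 ?_
  simp only [hS _ u v]
  exact VectorMeasure.tendsto_integral_filter_of_norm_le_const
    (Eventually.of_forall fun n => (hs n).aestronglyMeasurable)
    ⟨C, Eventually.of_forall fun n => ae_of_all _ (hC n)⟩ (ae_of_all _ hg)

/-- A bounded measurable function is a uniform limit of simple functions. -/
theorem exists_simpleFunc_uniform_approx {g : ℝ → ℂ} (hg : Measurable g) {C : ℝ}
    (hC : ∀ t, ‖g t‖ ≤ C) :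
    ∃ s : ℕ → SimpleFunc ℝ ℂ, ∀ n t, ‖s n t - g t‖ ≤ 2 / (n + 1) := by
  -- Round real and imaginary parts down to the grid of mesh 1/(n + 1); boundedness of `g` makes the
  -- set of grid points finite.
  let F (n : ℕ) (t : ℝ) : ℤ × ℤ := (⌊(n + 1) * (g t).re⌋, ⌊(n + 1) * (g t).im⌋)
  let c (n : ℕ) (p : ℤ × ℤ) : ℂ := ⟨p.1 / (n + 1), p.2 / (n + 1)⟩
  have hF (n : ℕ) : Measurable (F n) := by
    refine Measurable.prodMk ?_ ?_
    · exact Int.measurable_floor.comp (measurable_const.mul (Complex.measurable_re.comp hg))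
    · exact Int.measurable_floor.comp (measurable_const.mul (Complex.measurable_im.comp hg))
  have hfl (n : ℕ) (x : ℝ) (hx : |x| ≤ C) :
      ⌊(n + 1) * x⌋ ∈ Set.Icc ⌊-((n + 1) * C)⌋ ⌊(n + 1) * C⌋ := by
    have := abs_le.1 hx
    have hn : (0 : ℝ) < n + 1 := by positivity
    constructor <;> apply Int.floor_le_floor <;> nlinarith
  have hr (n : ℕ) : (Set.range (F n)).Finite := by
    refine ((Set.finite_Icc ⌊-((n + 1) * C)⌋ ⌊(n + 1) * C⌋).prod
      (Set.finite_Icc ⌊-((n + 1) * C)⌋ ⌊(n + 1) * C⌋)).subset ?_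
    rintro _ ⟨t, rfl⟩
    exact ⟨hfl n _ ((Complex.abs_re_le_norm _).trans (hC t)),
      hfl n _ ((Complex.abs_im_le_norm _).trans (hC t))⟩
  have hd (n : ℕ) (x : ℝ) : |(⌊(n + 1) * x⌋ : ℝ) / (n + 1) - x| ≤ 1 / (n + 1) := by
    have hn : (0 : ℝ) < n + 1 := by positivity
    have h1 := Int.floor_le ((n + 1) * x)
    have h2 := Int.lt_floor_add_one ((n + 1) * x)
    have : (⌊(n + 1) * x⌋ : ℝ) / (n + 1) - x = (⌊(n + 1) * x⌋ - (n + 1) * x) / (n + 1) := by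
      field_simp
    rw [this, abs_div, abs_of_pos hn]
    gcongr
    rw [abs_le]
    constructor <;> linarith
  refine ⟨fun n => (SimpleFunc.mk (F n) (fun p => hF n (measurableSet_singleton p)) (hr n)).map
    (c n), fun n t => ?_⟩
  refine (Complex.norm_le_abs_re_add_abs_im _).trans ?_
  have h1 := hd n (g t).re
  have h2 := hd n (g t).im
  calc _ ≤ 1 / ((n : ℝ) + 1) + 1 / (n + 1) := add_le_add h1 h2
    _ = _ := by ring

theorem simpleFunc_bounded (s : SimpleFunc ℝ ℂ) : ∃ C, ∀ t, ‖s t‖ ≤ C :=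
  s.exists_forall_norm_le

variable (E) in
theorem exists_isSpectralIntegral_simpleFunc (s : SimpleFunc ℝ ℂ) :
    ∃ T, E.IsSpectralIntegral s T := by
  induction s using SimpleFunc.induction with
  | @const c B hB =>
    refine ⟨c • E.proj B, ?_⟩
    convert isSpectralIntegral_indicator_const hB c using 1
    ext t
    by_cases ht : t ∈ B <;> simp [ht]
  | @add f g _ hf hg =>
    obtain ⟨S, hS⟩ := hf
    obtain ⟨T, hT⟩ := hg
    obtain ⟨C, hC⟩ := simpleFunc_bounded f
    obtain ⟨D, hD⟩ := simpleFunc_bounded g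
    exact ⟨S + T, hS.add hT f.measurable g.measurable hC hD⟩

theorem tendsto_two_div : Tendsto (fun n : ℕ => 2 / ((n : ℝ) + 1)) atTop (𝓝 0) := by
  have h := (tendsto_one_div_add_atTop_nhds_zero_nat (𝕜 := ℝ)).const_mul 2
  simp only [mul_zero] at h
  refine h.congr fun n => ?_
  ring

theorem tendsto_of_norm_sub_le {X : Type*} [NormedAddCommGroup X] {s : ℕ → X} {x : X} {C : ℝ}
    (h : ∀ n : ℕ, ‖s n - x‖ ≤ C * (2 / (n + 1))) : Tendsto s atTop (𝓝 x) := by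
  rw [tendsto_iff_norm_sub_tendsto_zero]
  exact squeeze_zero (fun _ => norm_nonneg _) h (by simpa using tendsto_two_div.const_mul C)

-- Uniform approximation by simple functions gives a Cauchy sequence of operators by `norm_le`; the
-- weak identity passes to the limit by dominated convergence.
variable (E) in
theorem exists_isSpectralIntegral {g : ℝ → ℂ} (hg : Measurable g) {C : ℝ}
    (hC : ∀ t, ‖g t‖ ≤ C) : ∃ T, E.IsSpectralIntegral g T := by
  obtain ⟨s, hs⟩ := exists_simpleFunc_uniform_approx hg hC
  choose S hS using fun n => E.exists_isSpectralIntegral_simpleFunc (s n)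
  have hdist (n m : ℕ) : ‖S n - S m‖ ≤ 2 * (2 / (n + 1) + 2 / (m + 1)) := by
    obtain ⟨A, hA⟩ := simpleFunc_bounded (s n)
    obtain ⟨B, hB⟩ := simpleFunc_bounded (s m)
    refine ((hS n).sub (hS m) (s n).measurable (s m).measurable hA hB).norm_le fun t => ?_
    rw [← sub_sub_sub_cancel_right _ _ (g t)]
    exact (norm_sub_le _ _).trans (add_le_add (hs n t) (hs m t))
  have hcauchy : CauchySeq S := by
    rw [cauchySeq_iff_tendsto_dist_atTop_0]
    refine squeeze_zero (fun _ => dist_nonneg) (fun p => (dist_eq_norm _ _).trans_le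
      (hdist p.1 p.2)) ?_
    have h := ((tendsto_two_div.comp tendsto_fst).add (tendsto_two_div.comp
      (tendsto_snd (f := atTop (α := ℕ)) (g := atTop (α := ℕ))))).const_mul 2
    rw [prod_atTop_atTop_eq] at h
    simpa using h
  obtain ⟨T, hT⟩ := cauchySeq_tendsto_of_complete hcauchy
  refine ⟨T, IsSpectralIntegral.of_tendsto hS (fun n => (s n).measurable) (C := C + 2)
    (fun n t => ?_) (fun t => tendsto_of_norm_sub_le (C := 1) fun n => by simpa using hs n t) hT⟩
  have h1 := norm_le_norm_add_norm_sub' (s n t) (g t)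
  have h2 : 2 / ((n : ℝ) + 1) ≤ 2 := div_le_self (by norm_num) (by simp)
  linarith [hs n t, hC t]

theorem IsSpectralIntegral.exists_approx {g : ℝ → ℂ} {T : K →L[ℂ] K}
    (hT : E.IsSpectralIntegral g T) (hg : Measurable g) {C : ℝ} (hC : ∀ t, ‖g t‖ ≤ C) :
    ∃ (s : ℕ → SimpleFunc ℝ ℂ) (S : ℕ → K →L[ℂ] K), (∀ n, E.IsSpectralIntegral (s n) (S n)) ∧
      Tendsto S atTop (𝓝 T) ∧ (∀ t, Tendsto (fun n => s n t) atTop (𝓝 (g t))) ∧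
      ∀ n t, ‖s n t‖ ≤ C + 2 := by
  obtain ⟨s, hs⟩ := exists_simpleFunc_uniform_approx hg hC
  choose S hS using fun n => E.exists_isSpectralIntegral_simpleFunc (s n)
  refine ⟨s, S, hS, ?_, fun t => tendsto_of_norm_sub_le (C := 1) fun n => by simpa using hs n t,
    fun n t => ?_⟩
  · refine tendsto_of_norm_sub_le (C := 2) fun n => ?_
    obtain ⟨A, hA⟩ := simpleFunc_bounded (s n)
    exact ((hS n).sub hT (s n).measurable hg hA hC).norm_le (hs n)
  · have h1 := norm_le_norm_add_norm_sub' (s n t) (g t)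
    have h2 : 2 / ((n : ℝ) + 1) ≤ 2 := div_le_self (by norm_num) (by simp)
    linarith [hs n t, hC t]

theorem IsSpectralIntegral.simpleFunc_mul {s : SimpleFunc ℝ ℂ} {h : ℝ → ℂ} {S T : K →L[ℂ] K}
    (hS : E.IsSpectralIntegral s S) (hT : E.IsSpectralIntegral h T) (hh : Measurable h) {C : ℝ}
    (hC : ∀ t, ‖h t‖ ≤ C) : E.IsSpectralIntegral (fun t => s t * h t) (S * T) := by
  induction s using SimpleFunc.induction generalizing S with
  | @const c B hB =>
    have h1 : E.IsSpectralIntegral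
        (SimpleFunc.piecewise B hB (SimpleFunc.const ℝ c) (SimpleFunc.const ℝ 0)) (c • E.proj B) := by
      convert isSpectralIntegral_indicator_const hB c using 1
      ext t
      by_cases ht : t ∈ B <;> simp [ht]
    rw [hS.unique h1, smul_mul_assoc]
    convert (hT.indicator hB).const_mul c using 2 with t
    by_cases ht : t ∈ B <;> simp [ht]
  | @add f g _ hf hg =>
    obtain ⟨A, hA⟩ := E.exists_isSpectralIntegral_simpleFunc f
    obtain ⟨B, hB⟩ := E.exists_isSpectralIntegral_simpleFunc g
    obtain ⟨a, ha⟩ := simpleFunc_bounded f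
    obtain ⟨b, hb⟩ := simpleFunc_bounded g
    rw [hS.unique (hA.add hB f.measurable g.measurable ha hb), add_mul]
    have hC0 : 0 ≤ C := (norm_nonneg _).trans (hC 0)
    convert (hf hA).add (hg hB) (f.measurable.mul hh) (g.measurable.mul hh)
      (C := a * C) (D := b * C) (fun t => ?_) (fun t => ?_) using 2 with t
    · simp [add_mul]
    · rw [norm_mul]
      exact mul_le_mul (ha t) (hC t) (norm_nonneg _) ((norm_nonneg _).trans (ha t))
    · rw [norm_mul]
      exact mul_le_mul (hb t) (hC t) (norm_nonneg _) ((norm_nonneg _).trans (hb t))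

/-- Multiplication by an indicator is composition with a projection. Linearity handles simple `g`,
and norm convergence handles bounded `g`. -/
theorem IsSpectralIntegral.mul {g h : ℝ → ℂ} {S T : K →L[ℂ] K}
    (hS : E.IsSpectralIntegral g S) (hT : E.IsSpectralIntegral h T) (hg : Measurable g)
    (hh : Measurable h) {C D : ℝ} (hC : ∀ t, ‖g t‖ ≤ C) (hD : ∀ t, ‖h t‖ ≤ D) :
    E.IsSpectralIntegral (fun t => g t * h t) (S * T) := by
  obtain ⟨s, A, hA, hlim, hs, hb⟩ := hS.exists_approx hg hC
  refine IsSpectralIntegral.of_tendsto (fun n => (hA n).simpleFunc_mul hT hh hD)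
    (fun n => (s n).measurable.mul hh) (C := (C + 2) * D) (fun n t => ?_)
    (fun t => (hs t).mul tendsto_const_nhds) (hlim.mul tendsto_const_nhds)
  rw [norm_mul]
  exact mul_le_mul (hb n t) (hD t) (norm_nonneg _) ((norm_nonneg _).trans (hb n t))

theorem IsSpectralIntegral.inner_self_simpleFunc {s : SimpleFunc ℝ ℂ} {S : K →L[ℂ] K}
    (hS : E.IsSpectralIntegral s S) (u : K) : ⟪u, S u⟫_ℂ = ∫ t, s t ∂(E.measure u) := by
  induction s using SimpleFunc.induction generalizing S with
  | @const c B hB =>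
    have h1 : ⇑(SimpleFunc.piecewise B hB (SimpleFunc.const ℝ c) (SimpleFunc.const ℝ 0)) =
        B.indicator fun _ => c := by
      ext t
      by_cases ht : t ∈ B <;> simp [ht]
    rw [h1] at hS ⊢
    rw [hS.unique (isSpectralIntegral_indicator_const hB c), integral_indicator hB,
      setIntegral_const, _root_.smul_apply, inner_smul_right, E.inner_proj_self hB,
      Measure.real, E.measure_apply u hB, ENNReal.toReal_ofReal (by positivity)]
    simp [mul_comm]
  | @add f g _ hf hg =>
    obtain ⟨A, hA⟩ := E.exists_isSpectralIntegral_simpleFunc f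
    obtain ⟨B, hB⟩ := E.exists_isSpectralIntegral_simpleFunc g
    obtain ⟨a, ha⟩ := simpleFunc_bounded f
    obtain ⟨b, hb⟩ := simpleFunc_bounded g
    rw [hS.unique (hA.add hB f.measurable g.measurable ha hb), _root_.add_apply,
      inner_add_right, hf hA, hg hB, ← integral_add]
    · rfl
    · exact Integrable.of_bound f.measurable.aestronglyMeasurable a (ae_of_all _ ha)
    · exact Integrable.of_bound g.measurable.aestronglyMeasurable b (ae_of_all _ hb)

/-- Bridge between the complex measures, which define the calculus and M, and the positive measures,
in which `IsResolutionOf` is phrased. -/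
theorem IsSpectralIntegral.inner_self {g : ℝ → ℂ} {T : K →L[ℂ] K} (hT : E.IsSpectralIntegral g T)
    (hg : Measurable g) {C : ℝ} (hC : ∀ t, ‖g t‖ ≤ C) (u : K) :
    ⟪u, T u⟫_ℂ = ∫ t, g t ∂(E.measure u) := by
  obtain ⟨s, A, hA, hlim, hs, hb⟩ := hT.exists_approx hg hC
  have h1 : Tendsto (fun n => ⟪u, A n u⟫_ℂ) atTop (𝓝 ⟪u, T u⟫_ℂ) :=
    tendsto_const_nhds.inner (((ContinuousLinearMap.apply ℂ K u).continuous.tendsto T).comp hlim)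
  refine tendsto_nhds_unique h1 ?_
  simp only [(hA _).inner_self_simpleFunc u]
  exact tendsto_integral_of_dominated_convergence (fun _ => C + 2)
    (fun n => (s n).measurable.aestronglyMeasurable) (integrable_const _)
    (fun n => ae_of_all _ (hb n)) (ae_of_all _ hs)

theorem measure_proj {B : Set ℝ} (hB : MeasurableSet B) (u : K) :
    E.measure (E.proj B u) = (E.measure u).restrict B := by
  ext A hA
  rw [Measure.restrict_apply hA, E.measure_apply _ hA, E.measure_apply _ (hA.inter hB),
    E.proj_proj hA hB]

/-- By Pythagoras the squared error is ‖u‖² - ‖E[-N, N]u‖², the spectral mass outside [-N, N], which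
vanishes in the limit by continuity of the measure. -/
theorem tendsto_proj_Icc (u : K) :
    Tendsto (fun N : ℕ => E.proj (Set.Icc (-(N : ℝ)) N) u) atTop (𝓝 u) := by
  have hmono : Monotone fun N : ℕ => Set.Icc (-(N : ℝ)) N := fun m n h => by
    have : (m : ℝ) ≤ n := by exact_mod_cast h
    exact Set.Icc_subset_Icc (by linarith) this
  have hU : (⋃ N : ℕ, Set.Icc (-(N : ℝ)) N) = Set.univ := by
    refine Set.eq_univ_of_forall fun t => Set.mem_iUnion.2 ?_
    obtain ⟨N, hN⟩ := exists_nat_ge |t|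
    exact ⟨N, abs_le.1 hN⟩
  have h1 := tendsto_measure_iUnion_atTop (μ := E.measure u) hmono
  rw [hU, E.measure_apply u .univ, E.univ] at h1
  have h2 := (ENNReal.tendsto_toReal ENNReal.ofReal_ne_top).comp h1
  have h3 (N : ℕ) : ((E.measure u) (Set.Icc (-(N : ℝ)) N)).toReal =
      ‖E.proj (Set.Icc (-(N : ℝ)) N) u‖ ^ 2 := by
    rw [E.measure_apply u measurableSet_Icc, ENNReal.toReal_ofReal (by positivity)]
  simp only [Function.comp_def, h3, one_apply_eq_self] at h2
  rw [ENNReal.toReal_ofReal (by positivity)] at h2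
  have h4 (N : ℕ) : ‖E.proj (Set.Icc (-(N : ℝ)) N) u - u‖ ^ 2 =
      ‖u‖ ^ 2 - ‖E.proj (Set.Icc (-(N : ℝ)) N) u‖ ^ 2 := by
    rw [norm_sub_rev, @norm_sub_sq ℂ]
    have := E.re_inner_proj (measurableSet_Icc (a := -(N : ℝ)) (b := N)) u
    simp only [RCLike.re_to_complex, this]
    ring
  rw [tendsto_iff_norm_sub_tendsto_zero]
  have h5 : Tendsto (fun N : ℕ => ‖E.proj (Set.Icc (-(N : ℝ)) N) u - u‖ ^ 2) atTop (𝓝 0) := by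
    simp only [h4]
    exact (sub_self (‖u‖ ^ 2)) ▸ h2.const_sub (‖u‖ ^ 2)
  simpa [Real.sqrt_sq (norm_nonneg _)] using h5.sqrt

end ResolutionOfIdentity

/-! ### The resolvent of an operator with a given resolution of the identity. -/

namespace ResolutionOfIdentity

variable {K : Type*} [NormedAddCommGroup K] [InnerProductSpace ℂ K] [CompleteSpace K]
variable {E : ResolutionOfIdentity K}

theorem IsResolutionOf.proj_Icc_mem_domain {H : K →ₗ.[ℂ] K} (hE : E.IsResolutionOf H) (a b : ℝ)
    (u : K) : E.proj (Set.Icc a b) u ∈ H.domain := by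
  rw [hE.1, measure_proj measurableSet_Icc]
  exact (continuous_pow 2).integrableOn_Icc

theorem measurable_indicator_ofReal (a b : ℝ) :
    Measurable ((Set.Icc a b).indicator fun t : ℝ => (t : ℂ)) :=
  Complex.measurable_ofReal.indicator measurableSet_Icc

theorem norm_indicator_ofReal_le (a b t : ℝ) :
    ‖(Set.Icc a b).indicator (fun t : ℝ => (t : ℂ)) t‖ ≤ |a| + |b| := by
  by_cases ht : t ∈ Set.Icc a b
  · rw [Set.indicator_of_mem ht, Complex.norm_real, Real.norm_eq_abs, abs_le]
    have := neg_abs_le a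
    have := le_abs_self b
    have := abs_nonneg a
    have := abs_nonneg b
    constructor <;> linarith [ht.1, ht.2]
  · rw [Set.indicator_of_notMem ht, norm_zero]; positivity

/-- The compression of `H` to a bounded spectral interval is the corresponding integral. -/
theorem IsResolutionOf.proj_apply_proj {H : K →ₗ.[ℂ] K} (hE : E.IsResolutionOf H) {a b : ℝ}
    {A : K →L[ℂ] K} (hA : E.IsSpectralIntegral ((Set.Icc a b).indicator fun t : ℝ => (t : ℂ)) A)
    (u : K) : E.proj (Set.Icc a b) (H ⟨_, hE.proj_Icc_mem_domain a b u⟩) = A u := by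
  let f : K →ₗ[ℂ] K := (E.proj (Set.Icc a b)).toLinearMap ∘ₗ H.toFun ∘ₗ
    (E.proj (Set.Icc a b)).toLinearMap.codRestrict H.domain (hE.proj_Icc_mem_domain a b)
  suffices h : f = A.toLinearMap from congrArg (fun T => T u) h
  -- On a complex space an operator is determined by its quadratic form, which is all that `hE`
  -- provides.
  rw [← ext_inner_map]
  intro v
  rw [← inner_conj_symm, ← inner_conj_symm (A.toLinearMap v)]
  congr 1
  have h1 : ⟪v, f v⟫_ℂ = ⟪E.proj (Set.Icc a b) v, H ⟨_, hE.proj_Icc_mem_domain a b v⟩⟫_ℂ :=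
    (E.inner_proj_left measurableSet_Icc v _).symm
  have h2 : ⟪v, A v⟫_ℂ = _ := hA.inner_self (measurable_indicator_ofReal a b)
    (norm_indicator_ofReal_le a b) v
  refine h1.trans (Eq.trans ?_ h2.symm)
  rw [hE.2 ⟨_, hE.proj_Icc_mem_domain a b v⟩, integral_indicator measurableSet_Icc,
    ← measure_proj measurableSet_Icc]
  exact (integral_ofReal (𝕜 := ℂ)).symm

theorem IsResolutionOf.apply_proj {H : K →ₗ.[ℂ] K} (hE : E.IsResolutionOf H) {N : ℕ}
    {A : K →L[ℂ] K}
    (hA : E.IsSpectralIntegral ((Set.Icc (-(N : ℝ)) N).indicator fun t : ℝ => (t : ℂ)) A)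
    (u : K) : H ⟨_, hE.proj_Icc_mem_domain (-(N : ℝ)) N u⟩ = A u := by
  set w := H ⟨_, hE.proj_Icc_mem_domain (-(N : ℝ)) N u⟩ with hw
  -- It suffices that E[-M, M]w = A u for M ≥ N: compressing to the larger interval still gives A
  -- because the vector already lies in the range of E[-N, N].
  refine tendsto_nhds_unique (tendsto_proj_Icc (E := E) w) ?_
  refine tendsto_const_nhds.congr' ?_
  filter_upwards [eventually_ge_atTop N] with M hM
  have hsub : Set.Icc (-(N : ℝ)) N ⊆ Set.Icc (-(M : ℝ)) M := by
    have : (N : ℝ) ≤ M := by exact_mod_cast hM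
    exact Set.Icc_subset_Icc (by linarith) this
  obtain ⟨B, hB⟩ := E.exists_isSpectralIntegral (measurable_indicator_ofReal (-(M : ℝ)) M)
    (norm_indicator_ofReal_le (-(M : ℝ)) M)
  have h1 := hE.proj_apply_proj hB (E.proj (Set.Icc (-(N : ℝ)) N) u)
  have h2 : E.proj (Set.Icc (-(M : ℝ)) M) (E.proj (Set.Icc (-(N : ℝ)) N) u) =
      E.proj (Set.Icc (-(N : ℝ)) N) u := by
    rw [E.proj_proj measurableSet_Icc measurableSet_Icc, Set.inter_eq_self_of_subset_right hsub]
  simp only [h2] at h1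
  rw [hw, h1]
  have h3 := hB.mul (isSpectralIntegral_indicator_const (E := E)
    (measurableSet_Icc (a := -(N : ℝ)) (b := N)) 1) (measurable_indicator_ofReal (-(M : ℝ)) M)
    (measurable_const.indicator measurableSet_Icc) (norm_indicator_ofReal_le (-(M : ℝ)) M)
    (fun t => (norm_indicator_le_norm_self _ t))
  have h4 : A = B * (1 : ℂ) • E.proj (Set.Icc (-(N : ℝ)) N) := by
    refine hA.unique ?_
    convert h3 using 2 with t
    by_cases ht : t ∈ Set.Icc (-(N : ℝ)) N
    · simp only [Set.indicator_of_mem ht, Set.indicator_of_mem (hsub ht), mul_one]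
    · simp only [Set.indicator_of_notMem ht, mul_zero]
  rw [h4, one_smul]
  rfl

theorem norm_inv_ofReal_sub_le {z : ℂ} (hz : z.im ≠ 0) (t : ℝ) :
    ‖1 / ((t : ℂ) - z)‖ ≤ 1 / |z.im| := by
  rw [norm_div, norm_one]
  refine one_div_le_one_div_of_le (abs_pos.2 hz) ?_
  simpa using Complex.abs_im_le_norm ((t : ℂ) - z)

theorem ofReal_sub_ne_zero {z : ℂ} (hz : z.im ≠ 0) (t : ℝ) : (t : ℂ) - z ≠ 0 := fun h => by
  have := congrArg Complex.im h
  simp at this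
  exact hz this

/-- On each [-N, N] the identity t/(t - z) = 1 + z/(t - z) gives the resolvent equation for the
truncated vectors. Closedness of H carries it to N → ∞. -/
theorem IsResolutionOf.exists_resolvent {H : K →ₗ.[ℂ] K} (hE : E.IsResolutionOf H)
    (hH : H.IsClosed) {z : ℂ} (hz : z.im ≠ 0) :
    ∃ R : K →L[ℂ] K, E.IsSpectralIntegral (fun t => 1 / ((t : ℂ) - z)) R ∧
      ∀ v, ∃ w : H.domain, (w : K) = R v ∧ H w = z • (w : K) + v := by
  have hgm : Measurable fun t : ℝ => 1 / ((t : ℂ) - z) :=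
    measurable_const.div (Complex.measurable_ofReal.sub measurable_const)
  obtain ⟨R, hR⟩ := E.exists_isSpectralIntegral hgm (norm_inv_ofReal_sub_le hz)
  refine ⟨R, hR, fun v => ?_⟩
  have key (N : ℕ) : H ⟨_, hE.proj_Icc_mem_domain (-(N : ℝ)) N (R v)⟩ =
      E.proj (Set.Icc (-(N : ℝ)) N) (v + z • R v) := by
    obtain ⟨A, hA⟩ := E.exists_isSpectralIntegral (measurable_indicator_ofReal (-(N : ℝ)) N)
      (norm_indicator_ofReal_le (-(N : ℝ)) N)
    rw [hE.apply_proj hA]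
    have h1 := hA.mul hR (measurable_indicator_ofReal (-(N : ℝ)) N) hgm
      (norm_indicator_ofReal_le (-(N : ℝ)) N) (norm_inv_ofReal_sub_le hz)
    have hI := isSpectralIntegral_indicator_const (E := E)
      (measurableSet_Icc (a := -(N : ℝ)) (b := N)) 1
    have h2 := (hR.indicator (measurableSet_Icc (a := -(N : ℝ)) (b := N))).const_mul z
    have h3 := hI.add h2 (measurable_const.indicator measurableSet_Icc)
      ((hgm.indicator measurableSet_Icc).const_mul z)
      (fun t => norm_indicator_le_norm_self _ t) (D := ‖z‖ * (1 / |z.im|)) (fun t => by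
        rw [norm_mul]
        gcongr
        exact (norm_indicator_le_norm_self _ t).trans (norm_inv_ofReal_sub_le hz t))
    have h4 : A * R = (1 : ℂ) • E.proj (Set.Icc (-(N : ℝ)) N) +
        z • (E.proj (Set.Icc (-(N : ℝ)) N) * R) := by
      refine h1.unique ?_
      convert h3 using 2 with t
      by_cases ht : t ∈ Set.Icc (-(N : ℝ)) N
      · simp only [Set.indicator_of_mem ht]
        have := ofReal_sub_ne_zero hz t
        field_simp
        ring
      · simp [Set.indicator_of_notMem ht]
    have h5 := congrArg (fun T => T v) h4
    simpa using h5
  have hmem : (R v, v + z • R v) ∈ (H.graph : Set (K × K)) := by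
    have hcl : IsClosed (H.graph : Set (K × K)) := hH
    refine hcl.mem_of_tendsto (b := atTop) (f := fun N : ℕ =>
      (E.proj (Set.Icc (-(N : ℝ)) N) (R v), E.proj (Set.Icc (-(N : ℝ)) N) (v + z • R v))) ?_
      (Eventually.of_forall fun N => ?_)
    · exact (tendsto_proj_Icc (R v)).prodMk_nhds (tendsto_proj_Icc (v + z • R v))
    · change _ ∈ H.graph
      rw [← key N]
      exact H.mem_graph ⟨_, _⟩
  obtain ⟨w, hw1, hw2⟩ := (LinearPMap.mem_graph_iff H).1 hmem
  refine ⟨w, hw1, hw2.trans ?_⟩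
  rw [hw1]
  exact add_comm _ _

/-- The quadratic form of `H` is real, so the resolvent satisfies `Im ⟪v, R v⟫ = Im z ‖R v‖²`. -/
theorem IsResolutionOf.im_inner_resolvent {H : K →ₗ.[ℂ] K} (hE : E.IsResolutionOf H) {z : ℂ}
    {v : K} {w : H.domain} (hw : H w = z • (w : K) + v) :
    (⟪v, (w : K)⟫_ℂ).im = z.im * ‖(w : K)‖ ^ 2 := by
  have h := congrArg Complex.im (hE.2 w)
  rw [hw, inner_add_right, inner_smul_right, inner_self_eq_norm_sq_to_K, Complex.ofReal_im] at h
  rw [← inner_conj_symm, Complex.conj_im]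
  have h2 : (z * ((‖(w : K)‖ : ℂ)) ^ 2).im = z.im * ‖(w : K)‖ ^ 2 := by
    rw [← Complex.ofReal_pow, Complex.im_mul_ofReal]
  rw [Complex.add_im] at h
  have h3 := h2 ▸ h
  linarith

end ResolutionOfIdentity

/-! ### Frobenius norms, closedness of the Dirichlet operator and the Weyl solution. -/

variable {l : ℕ}

theorem frobenius_norm_sq {𝕜 : Type*} [RCLike 𝕜] (A : Matrix (Fin l) (Fin l) 𝕜) :
    ‖A‖ ^ 2 = ∑ i, ∑ j, ‖A i j‖ ^ 2 := by
  rw [Matrix.frobenius_norm_def, ← Real.rpow_natCast, ← Real.rpow_mul (by positivity)]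
  norm_num

theorem frobenius_norm_sq_eq_sum_col (A : Matrix (Fin l) (Fin l) ℂ) :
    ‖A‖ ^ 2 = ∑ k, ‖WithLp.toLp 2 (A.col k)‖ ^ 2 := by
  rw [frobenius_norm_sq, Finset.sum_comm]
  simp [EuclideanSpace.norm_sq_eq, Matrix.col]

theorem norm_entry_le_frobenius (A : Matrix (Fin l) (Fin l) ℂ) (i j : Fin l) : ‖A i j‖ ≤ ‖A‖ := by
  refine le_of_sq_le_sq ?_ (norm_nonneg A)
  rw [frobenius_norm_sq]
  refine (Finset.single_le_sum (f := fun j => ‖A i j‖ ^ 2) (fun _ _ => by positivity)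
    (Finset.mem_univ j)).trans ?_
  exact Finset.single_le_sum (f := fun i => ∑ j, ‖A i j‖ ^ 2) (fun _ _ => by positivity)
    (Finset.mem_univ i)

theorem isUnit_toComplex {A : Matrix (Fin l) (Fin l) ℝ} (hA : IsUnit A) : IsUnit (toComplex A) :=
  hA.map (Complex.ofRealHom.mapMatrix (m := Fin l))

theorem toComplex_mul_inv {A : Matrix (Fin l) (Fin l) ℝ} (hA : IsUnit A) :
    toComplex A * (toComplex A)⁻¹ = 1 :=
  Matrix.mul_nonsing_inv _ ((Matrix.isUnit_iff_isUnit_det _).1 (isUnit_toComplex hA))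

theorem toComplex_inv_mul {A : Matrix (Fin l) (Fin l) ℝ} (hA : IsUnit A) :
    (toComplex A)⁻¹ * toComplex A = 1 :=
  Matrix.nonsing_inv_mul _ ((Matrix.isUnit_iff_isUnit_det _).1 (isUnit_toComplex hA))

theorem toComplex_inv {A : Matrix (Fin l) (Fin l) ℝ} (hA : IsUnit A) :
    toComplex A⁻¹ = (toComplex A)⁻¹ := by
  refine (Matrix.inv_eq_right_inv ?_).symm
  have h : A * A⁻¹ = 1 := Matrix.mul_nonsing_inv _ ((Matrix.isUnit_iff_isUnit_det _).1 hA)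
  have := congrArg (Complex.ofRealHom.mapMatrix (m := Fin l)) h
  rwa [map_mul, map_one] at this

theorem norm_toComplex (A : Matrix (Fin l) (Fin l) ℝ) : ‖toComplex A‖ = ‖A‖ :=
  Matrix.frobenius_norm_map_eq A _ fun a => Complex.norm_real a

theorem continuous_dirichletExt (n : ℕ) :
    Continuous fun u : HalfLine l => dirichletExt (u : ℕ → EuclideanSpace ℂ (Fin l)) n := by
  cases n with
  | zero => exact continuous_const
  | succ n => exact (lp.lipschitzWith_one_eval 2 n).continuous

/-- The domain is maximal, so the graph is cut out by the equations at the individual sites. Each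
involves finitely many coordinates and is a closed condition. -/
theorem isClosed_dirichletOperator (D V : ℕ → Matrix (Fin l) (Fin l) ℝ) :
    (dirichletOperator D V).IsClosed := by
  have h : ((dirichletOperator D V).graph : Set (HalfLine l × HalfLine l)) =
      ⋂ n : ℕ, {p | jacobi D V (dirichletExt p.1) n = p.2 n} := by
    ext ⟨u, f⟩
    simp only [SetLike.mem_coe, LinearPMap.mem_graph_iff, Set.mem_iInter, Set.mem_ofPred_eq]
    constructor
    · rintro ⟨w, rfl, rfl⟩ n
      rfl
    · intro h
      have h1 : jacobi D V (dirichletExt u) = f := funext h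
      have h2 : u ∈ (dirichletOperator D V).domain := by
        change Memℓp (jacobi D V (dirichletExt u)) 2
        rw [h1]
        exact lp.memℓp f
      exact ⟨⟨u, h2⟩, rfl, Subtype.ext h1⟩
  unfold LinearPMap.IsClosed
  rw [h]
  refine isClosed_iInter fun n => isClosed_eq ?_ ?_
  · have hc (A : Matrix (Fin l) (Fin l) ℝ) (m : ℕ) : Continuous fun p : HalfLine l × HalfLine l =>
        Matrix.toEuclideanLin (toComplex A)
          (dirichletExt (p.1 : ℕ → EuclideanSpace ℂ (Fin l)) m) :=
      (LinearMap.continuous_of_finiteDimensional _).comp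
        ((continuous_dirichletExt m).comp continuous_fst)
    exact ((hc _ _).add (hc _ _)).add (hc _ _)
  · exact (lp.lipschitzWith_one_eval 2 n).continuous.comp continuous_snd

theorem inner_siteOne (j : Fin l) (u : HalfLine l) : ⟪siteOne j, u⟫_ℂ = (u 0).ofLp j := by
  rw [siteOne, lp.inner_single_left, EuclideanSpace.inner_single_left]
  simp

theorem sum_norm_sq_le_norm_sq (u : HalfLine l) (s : Finset ℕ) :
    ∑ n ∈ s, ‖u n‖ ^ 2 ≤ ‖u‖ ^ 2 := by
  have h := lp.sum_rpow_le_norm_rpow (p := 2) (by norm_num) u s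
  simpa using h

/-- The square summable solution at a nonreal energy `z` which is normalised at the site `0`. Its
value at the site `1` is the Weyl–Titchmarsh matrix. -/
theorem exists_weyl_solution {D V : ℕ → Matrix (Fin l) (Fin l) ℝ} (hD : IsUnit (D 0))
    {E : ResolutionOfIdentity (HalfLine l)} (hE : E.IsResolutionOf (dirichletOperator D V))
    {z : ℂ} (hz : 0 < z.im) :
    ∃ F : ℕ → Matrix (Fin l) (Fin l) ℂ, F 0 = -(toComplex (D 0))⁻¹ ∧ F 1 = weylM E z ∧
      (∀ n, toComplex (D n) * F n + toComplex (D (n + 1)) * F (n + 2)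
        + toComplex (V (n + 1)) * F (n + 1) = z • F (n + 1)) ∧
      ∀ N, z.im * ∑ n ∈ Finset.Icc 1 N, ‖F n‖ ^ 2 ≤ l * ‖weylM E z‖ := by
  obtain ⟨R, hR, hdom⟩ := hE.exists_resolvent (isClosed_dirichletOperator D V) hz.ne'
  choose w hw1 hw2 using fun k : Fin l => hdom (siteOne k)
  have hM (j k : Fin l) : ((w k : HalfLine l) 0).ofLp j = weylM E z j k := by
    rw [hw1, ← inner_siteOne]
    exact hR _ _
  have hrec (k : Fin l) (n : ℕ) : jacobi D V (dirichletExt (w k : HalfLine l)) n =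
      z • (w k : HalfLine l) n + siteOne k n :=
    congrArg (fun f : HalfLine l => f n) (hw2 k)
  -- The source e_{1,k} at site 1 is traded for the boundary value at site 0: D_0 F_0 = -I turns the
  -- inhomogeneous equation into the homogeneous recurrence.
  refine ⟨fun n => n.casesOn (-(toComplex (D 0))⁻¹)
    fun n => Matrix.of fun j k => ((w k : HalfLine l) n).ofLp j, rfl, ?_, ?_, ?_⟩
  · ext j k
    exact hM j k
  · intro n
    ext j k
    have h := congrArg (fun v : EuclideanSpace ℂ (Fin l) => v.ofLp j) (hrec k n)
    cases n with
    | zero =>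
      have h4 : (toComplex (D 0) * -(toComplex (D 0))⁻¹) j k = -(if j = k then (1 : ℂ) else 0) := by
        rw [mul_neg, toComplex_mul_inv hD, Matrix.neg_apply, Matrix.one_apply]
      simp only [jacobi, dirichletExt, siteOne, map_zero, zero_add, PiLp.add_apply, PiLp.smul_apply,
        Matrix.ofLp_toLpLin, lp.single_apply_self, PiLp.single_apply] at h
      have h2 : (toComplex (D 1) * Matrix.of fun j k => ((w k : HalfLine l) 1).ofLp j) j k +
          (toComplex (V 1) * Matrix.of fun j k => ((w k : HalfLine l) 0).ofLp j) j k =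
          z • ((w k : HalfLine l) 0).ofLp j + if j = k then 1 else 0 := h
      change (toComplex (D 0) * -(toComplex (D 0))⁻¹) j k +
        (toComplex (D 1) * Matrix.of fun j k => ((w k : HalfLine l) 1).ofLp j) j k +
        (toComplex (V 1) * Matrix.of fun j k => ((w k : HalfLine l) 0).ofLp j) j k =
        z • ((w k : HalfLine l) 0).ofLp j
      linear_combination h2 + h4
    | succ n =>
      have h3 : siteOne k (n + 1) = 0 := by
        rw [siteOne, lp.single_apply_ne _ _ _ (by simp)]
      rw [h3, add_zero] at h
      exact h
  · intro N
    have hsum : ∑ n ∈ Finset.Icc 1 N, ‖(Nat.casesOn n (-(toComplex (D 0))⁻¹)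
        fun n => Matrix.of fun j k => ((w k : HalfLine l) n).ofLp j :
          Matrix (Fin l) (Fin l) ℂ)‖ ^ 2 ≤ ∑ k, ‖(w k : HalfLine l)‖ ^ 2 := by
      rw [← Finset.Ico_add_one_right_eq_Icc, Finset.sum_Ico_eq_sum_range, Nat.add_sub_cancel]
      calc _ = ∑ n ∈ Finset.range N, ∑ k, ‖(w k : HalfLine l) n‖ ^ 2 := by
            refine Finset.sum_congr rfl fun n _ => ?_
            rw [add_comm 1 n, frobenius_norm_sq_eq_sum_col]
            rfl
        _ = ∑ k, ∑ n ∈ Finset.range N, ‖(w k : HalfLine l) n‖ ^ 2 := Finset.sum_comm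
        _ ≤ _ := Finset.sum_le_sum fun k _ => sum_norm_sq_le_norm_sq _ _
    refine (mul_le_mul_of_nonneg_left hsum hz.le).trans ?_
    rw [Finset.mul_sum]
    -- The left side equals Im M_kk; summing over the l columns produces the factor l.
    have hk (k : Fin l) : z.im * ‖(w k : HalfLine l)‖ ^ 2 ≤ ‖weylM E z‖ := by
      rw [← hE.im_inner_resolvent (hw2 k), inner_siteOne, hM]
      exact (Complex.im_le_norm _).trans (norm_entry_le_frobenius _ _ _)
    refine (Finset.sum_le_sum fun k _ => hk k).trans ?_
    simp

/-! ### The Green kernel and variation of parameters. -/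

theorem toComplex_transpose {A : Matrix (Fin l) (Fin l) ℝ} (hA : A.IsSymm) :
    (toComplex A).transpose = toComplex A := by
  rw [toComplex, ← Matrix.transpose_map, hA]

theorem toComplex_inv_transpose {A : Matrix (Fin l) (Fin l) ℝ} (hA : A.IsSymm) :
    ((toComplex A)⁻¹).transpose = (toComplex A)⁻¹ := by
  rw [Matrix.transpose_nonsing_inv, toComplex_transpose hA]

open Matrix in
/-- The kernel `ψ_n D₀⁻¹ φ_mᵀ - φ_n D₀⁻¹ ψ_mᵀ` of the variation of parameters formula. -/
noncomputable def greenKernel (D V : ℕ → Matrix (Fin l) (Fin l) ℝ) (x : ℂ) (n m : ℕ) :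
    Matrix (Fin l) (Fin l) ℂ :=
  psi D V x n * (toComplex (D 0))⁻¹ * (phi D V x m)ᵀ
    - phi D V x n * (toComplex (D 0))⁻¹ * (psi D V x m)ᵀ

section

variable {D V : ℕ → Matrix (Fin l) (Fin l) ℝ} {x : ℂ}

theorem solution_add_two (hD : ∀ n, IsUnit (D n)) (A B : Matrix (Fin l) (Fin l) ℂ) (n : ℕ) :
    toComplex (D (n + 1)) * solution D V x A B (n + 2) =
      (x • 1 - toComplex (V (n + 1))) * solution D V x A B (n + 1)
        - toComplex (D n) * solution D V x A B n := by
  have h := solution_eq D V hD x A B n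
  rw [sub_mul, smul_mul_assoc, one_mul, ← h]
  abel

theorem transpose_greenKernel (hS : (D 0).IsSymm) (n m : ℕ) :
    (greenKernel D V x n m).transpose = -greenKernel D V x m n := by
  simp only [greenKernel, Matrix.transpose_sub, Matrix.transpose_mul, Matrix.transpose_transpose,
    toComplex_inv_transpose hS, mul_assoc]
  abel

theorem greenKernel_add_two (hD : ∀ n, IsUnit (D n)) (n m : ℕ) :
    toComplex (D (n + 1)) * greenKernel D V x (n + 2) m =
      (x • 1 - toComplex (V (n + 1))) * greenKernel D V x (n + 1) m
        - toComplex (D n) * greenKernel D V x n m := by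
  simp only [greenKernel, mul_sub, ← mul_assoc, phi, psi, solution_add_two hD]
  simp only [sub_mul]
  abel

/-- The three identities are proved together: the recurrence in the first index and the antisymmetry
`transpose_greenKernel` propagate them from n to n + 1. They are the companions of the Wronskian
identity with the factors in the opposite order. -/
theorem greenKernel_self_and_succ (hD : ∀ n, IsUnit (D n)) (hDs : ∀ n, (D n).IsSymm)
    (hVs : ∀ n, (V n).IsSymm) (n : ℕ) :
    greenKernel D V x n n = 0 ∧ greenKernel D V x (n + 1) (n + 1) = 0 ∧
      greenKernel D V x (n + 1) n = -(toComplex (D n))⁻¹ := by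
  induction n with
  | zero => simp [greenKernel, phi, psi, solution]
  | succ n ih =>
    obtain ⟨h0, h1, h2⟩ := ih
    have cancel {X Y : Matrix (Fin l) (Fin l) ℂ} (h : toComplex (D (n + 1)) * X = Y) :
        X = (toComplex (D (n + 1)))⁻¹ * Y := by
      rw [← h, ← mul_assoc, toComplex_inv_mul (hD _), one_mul]
    have hswap (i j : ℕ) : greenKernel D V x i j = -(greenKernel D V x j i).transpose := by
      rw [transpose_greenKernel (hDs 0), neg_neg]
    have h3 : greenKernel D V x n (n + 1) = (toComplex (D n))⁻¹ := by
      rw [hswap, h2, Matrix.transpose_neg, neg_neg, toComplex_inv_transpose (hDs n)]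
    have h4 : greenKernel D V x (n + 2) (n + 1) = -(toComplex (D (n + 1)))⁻¹ := by
      rw [cancel (greenKernel_add_two hD n (n + 1)), h1, h3, toComplex_mul_inv (hD n)]
      simp
    have h5 : greenKernel D V x (n + 1) (n + 2) = (toComplex (D (n + 1)))⁻¹ := by
      rw [hswap, h4, Matrix.transpose_neg, neg_neg, toComplex_inv_transpose (hDs _)]
    have h6 : greenKernel D V x n (n + 2) = (toComplex (D n))⁻¹ *
        (x • 1 - toComplex (V (n + 1))) * (toComplex (D (n + 1)))⁻¹ := by
      rw [hswap, cancel (greenKernel_add_two hD n n), h0, h2]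
      simp only [mul_zero, sub_zero, Matrix.transpose_mul, Matrix.transpose_neg,
        Matrix.transpose_sub, Matrix.transpose_smul, Matrix.transpose_one,
        toComplex_inv_transpose (hDs _), toComplex_transpose (hVs _)]
      simp
    refine ⟨h1, ?_, h4⟩
    rw [cancel (greenKernel_add_two hD n (n + 2)), h5, h6, ← mul_assoc (toComplex (D n)),
      ← mul_assoc (toComplex (D n)), toComplex_mul_inv (hD n), one_mul, sub_self, mul_zero]

open Matrix in
/-- Variation of parameters for a solution at the energy `z` in terms of solutions at `x`. -/
theorem variation_of_parameters (hD : ∀ n, IsUnit (D n)) (hDs : ∀ n, (D n).IsSymm)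
    (hVs : ∀ n, (V n).IsSymm) {z : ℂ} {F : ℕ → Matrix (Fin l) (Fin l) ℂ}
    (hF : ∀ n, toComplex (D n) * F n + toComplex (D (n + 1)) * F (n + 2)
        + toComplex (V (n + 1)) * F (n + 1) = z • F (n + 1)) (n : ℕ) :
    let A := F 0 - (z - x) • ((toComplex (D 0))⁻¹ *
      ∑ m ∈ Finset.Icc 1 n, (phi D V x m)ᵀ * F m)
    let B := F 1 + (z - x) • ((toComplex (D 0))⁻¹ *
      ∑ m ∈ Finset.Icc 1 n, (psi D V x m)ᵀ * F m)
    F n = psi D V x n * A + phi D V x n * B ∧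
      F (n + 1) = psi D V x (n + 1) * A + phi D V x (n + 1) * B := by
  induction n with
  | zero => simp [phi, psi, solution]
  | succ n ih =>
    obtain ⟨h0, h1⟩ := ih
    obtain ⟨-, g1, -⟩ := greenKernel_self_and_succ (x := x) hD hDs hVs n
    obtain ⟨-, -, g2⟩ := greenKernel_self_and_succ (x := x) hD hDs hVs (n + 1)
    simp only [Finset.sum_Icc_succ_top (Nat.le_add_left 1 n)]
    set P := ∑ m ∈ Finset.Icc 1 n, (phi D V x m)ᵀ * F m
    set Q := ∑ m ∈ Finset.Icc 1 n, (psi D V x m)ᵀ * F m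
    -- Adding the summand m = n + 1 changes the combination at site k by a Green kernel term. It
    -- vanishes at k = n + 1, and at k = n + 2 it supplies exactly the discrepancy between the
    -- recurrences at z and at x.
    have step (k : ℕ) : psi D V x k * (F 0 - (z - x) • ((toComplex (D 0))⁻¹ *
          (P + (phi D V x (n + 1))ᵀ * F (n + 1)))) +
        phi D V x k * (F 1 + (z - x) • ((toComplex (D 0))⁻¹ *
          (Q + (psi D V x (n + 1))ᵀ * F (n + 1)))) =
        psi D V x k * (F 0 - (z - x) • ((toComplex (D 0))⁻¹ * P)) +
        phi D V x k * (F 1 + (z - x) • ((toComplex (D 0))⁻¹ * Q)) -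
        (z - x) • (greenKernel D V x k (n + 1) * F (n + 1)) := by
      simp only [greenKernel, mul_add, mul_sub, sub_mul, smul_add, smul_sub, mul_smul_comm,
        mul_assoc]
      abel
    refine ⟨?_, ?_⟩
    · rw [step, g1, zero_mul, smul_zero, sub_zero]
      exact h1
    · rw [step, g2]
      have cancel {X Y : Matrix (Fin l) (Fin l) ℂ}
          (h : toComplex (D (n + 1)) * X = toComplex (D (n + 1)) * Y) : X = Y := by
        rw [← one_mul X, ← one_mul Y, ← toComplex_inv_mul (hD (n + 1)), mul_assoc, h, mul_assoc]
      apply cancel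
      set A := F 0 - (z - x) • ((toComplex (D 0))⁻¹ * P)
      set B := F 1 + (z - x) • ((toComplex (D 0))⁻¹ * Q)
      have e1 : toComplex (D (n + 1)) * (psi D V x (n + 2) * A + phi D V x (n + 2) * B) =
          (x • 1 - toComplex (V (n + 1))) * F (n + 1) - toComplex (D n) * F n := by
        rw [mul_add, ← mul_assoc, ← mul_assoc, psi, phi, solution_add_two hD, solution_add_two hD,
          h0, h1]
        simp only [psi, phi, mul_add, sub_mul, mul_assoc]
        abel
      rw [mul_sub, e1, neg_mul, smul_neg, mul_neg, mul_smul_comm, ← mul_assoc,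
        toComplex_mul_inv (hD (n + 1)), one_mul]
      have h2 := hF n
      rw [← sub_eq_zero] at h2 ⊢
      rw [← h2]
      simp only [sub_mul, smul_mul_assoc, one_mul, sub_smul]
      abel

end

/-! ### The smallest singular value. -/

/-- Expand ‖T x‖² in an eigenbasis of T*T and bound every eigenvalue below by the last one. Singular
values are indexed from 0, hence n - 1. -/
theorem singularValues_last_mul_norm_le {G : Type*} [NormedAddCommGroup G] [InnerProductSpace ℂ G]
    [FiniteDimensional ℂ G] (T : G →ₗ[ℂ] G) {n : ℕ} (hn : Module.finrank ℂ G = n) (hpos : 0 < n)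
    (x : G) : T.singularValues (n - 1) * ‖x‖ ≤ ‖T x‖ := by
  have hlt : n - 1 < n := Nat.sub_lt hpos one_pos
  have hT := T.isSymmetric_adjoint_comp_self
  let b := hT.eigenvectorBasis hn
  have h1 : ‖T x‖ ^ 2 = ∑ i, hT.eigenvalues hn i * ‖⟪b i, x⟫_ℂ‖ ^ 2 := by
    have h2 : ((‖T x‖ : ℂ)) ^ 2 = ⟪x, (LinearMap.adjoint T ∘ₗ T) x⟫_ℂ := by
      rw [LinearMap.comp_apply, LinearMap.adjoint_inner_right]
      exact (inner_self_eq_norm_sq_to_K (𝕜 := ℂ) (T x)).symm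
    have h3 (i : Fin n) : ⟪b i, (LinearMap.adjoint T ∘ₗ T) x⟫_ℂ =
        hT.eigenvalues hn i * ⟪b i, x⟫_ℂ := by
      rw [← hT, hT.apply_eigenvectorBasis hn i, inner_smul_left]
      simp [b]
    rw [← b.sum_inner_mul_inner] at h2
    have h4 : ((‖T x‖ ^ 2 : ℝ) : ℂ) =
        ((∑ i, hT.eigenvalues hn i * ‖⟪b i, x⟫_ℂ‖ ^ 2 : ℝ) : ℂ) := by
      push_cast
      rw [h2]
      refine Finset.sum_congr rfl fun i _ => ?_
      rw [h3, ← inner_conj_symm, mul_left_comm, Complex.conj_mul']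
    exact_mod_cast h4
  have h5 : ‖x‖ ^ 2 = ∑ i, ‖⟪b i, x⟫_ℂ‖ ^ 2 := (b.sum_sq_norm_inner_right x).symm
  refine le_of_sq_le_sq ?_ (norm_nonneg _)
  rw [mul_pow, h1, h5, Finset.mul_sum, T.sq_singularValues_of_lt hn hlt]
  refine Finset.sum_le_sum fun i _ => mul_le_mul_of_nonneg_right ?_ (by positivity)
  exact hT.eigenvalues_antitone hn (Fin.mk_le_mk.2 (Nat.le_sub_one_of_lt i.2))

theorem singularValue_nonneg (k : ℕ) (A : Matrix (Fin l) (Fin l) ℂ) : 0 ≤ singularValue k A :=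
  LinearMap.singularValues_nonneg _ _

theorem singularValue_mul_norm_le (hl : 1 ≤ l) (A X : Matrix (Fin l) (Fin l) ℂ) :
    singularValue l A * ‖X‖ ≤ ‖A * X‖ := by
  refine le_of_sq_le_sq ?_ (norm_nonneg _)
  rw [mul_pow, frobenius_norm_sq_eq_sum_col, frobenius_norm_sq_eq_sum_col, Finset.mul_sum]
  refine Finset.sum_le_sum fun k _ => ?_
  rw [← mul_pow]
  have h := singularValues_last_mul_norm_le (Matrix.toEuclideanLin A) (n := l) (by simp) hl
    (WithLp.toLp 2 (X.col k))
  exact pow_le_pow_left₀ (mul_nonneg (singularValue_nonneg _ _) (norm_nonneg _)) h 2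

theorem one_le_norm_one (hl : 1 ≤ l) : 1 ≤ ‖(1 : Matrix (Fin l) (Fin l) ℂ)‖ := by
  have h := norm_entry_le_frobenius (1 : Matrix (Fin l) (Fin l) ℂ) ⟨0, hl⟩ ⟨0, hl⟩
  simpa using h

theorem singularValue_le_norm (hl : 1 ≤ l) (A : Matrix (Fin l) (Fin l) ℂ) :
    singularValue l A ≤ ‖A‖ := by
  have h := singularValue_mul_norm_le hl A 1
  rw [mul_one] at h
  exact (le_mul_of_one_le_right (singularValue_nonneg _ _) (one_le_norm_one hl)).trans h

theorem singularValue_one_pos (hl : 1 ≤ l) :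
    0 < singularValue l (1 : Matrix (Fin l) (Fin l) ℂ) := by
  have hinj : Function.Injective (Matrix.toEuclideanLin (1 : Matrix (Fin l) (Fin l) ℂ)) := by
    intro u v huv
    simpa using huv
  refine (LinearMap.injective_iff_forall_lt_finrank_singularValues_pos _).1 hinj _ ?_
  rw [finrank_euclideanSpace_fin]
  omega

/-! ### Truncated ℓ² norms as weighted norms. -/

/-- The weight of the site `n ≤ ⌊L⌋ + 1` in the truncated sum of length `L`. -/
noncomputable def truncWeight (L : ℝ) (n : ℕ) : ℝ := if n ≤ ⌊L⌋₊ then 1 else L - ⌊L⌋₊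

/-- The truncated `ℓ²` norm of a real sequence. -/
noncomputable def truncL2 (L : ℝ) (a : ℕ → ℝ) : ℝ :=
  √(∑ n ∈ Finset.Icc 1 (⌊L⌋₊ + 1), truncWeight L n * a n ^ 2)

theorem sum_truncWeight (L : ℝ) (a : ℕ → ℝ) :
    ∑ n ∈ Finset.Icc 1 (⌊L⌋₊ + 1), truncWeight L n * a n =
      ∑ n ∈ Finset.Icc 1 ⌊L⌋₊, a n + (L - ⌊L⌋₊) * a (⌊L⌋₊ + 1) := by
  rw [Finset.sum_Icc_succ_top (Nat.le_add_left 1 _)]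
  congr 1
  · refine Finset.sum_congr rfl fun n hn => ?_
    rw [truncWeight, if_pos (Finset.mem_Icc.1 hn).2, one_mul]
  · rw [truncWeight, if_neg (by omega)]

theorem truncNorm_eq_truncL2 (B : ℕ → Matrix (Fin l) (Fin l) ℂ) (L : ℝ) :
    truncNorm B L = truncL2 L fun n => ‖B n‖ := by
  rw [truncNorm, truncL2, sum_truncWeight]

theorem truncSingularValue_eq_truncL2 (k : ℕ) (B : ℕ → Matrix (Fin l) (Fin l) ℂ) (L : ℝ) :
    truncSingularValue k B L = truncL2 L fun n => singularValue k (B n) := by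
  rw [truncSingularValue, truncL2, sum_truncWeight]

section truncL2

variable {L : ℝ}

theorem truncWeight_nonneg (hL : 1 ≤ L) (n : ℕ) : 0 ≤ truncWeight L n := by
  unfold truncWeight
  split_ifs
  · exact zero_le_one
  · exact sub_nonneg.2 (Nat.floor_le (by linarith))

theorem truncWeight_le_one (L : ℝ) (n : ℕ) : truncWeight L n ≤ 1 := by
  unfold truncWeight
  split_ifs
  · exact le_rfl
  · have := Nat.lt_floor_add_one L
    linarith

theorem truncL2_sq (hL : 1 ≤ L) (a : ℕ → ℝ) :
    truncL2 L a ^ 2 = ∑ n ∈ Finset.Icc 1 (⌊L⌋₊ + 1), truncWeight L n * a n ^ 2 :=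
  Real.sq_sqrt (Finset.sum_nonneg fun n _ => mul_nonneg (truncWeight_nonneg hL n) (sq_nonneg _))

theorem truncL2_nonneg (a : ℕ → ℝ) : 0 ≤ truncL2 L a := Real.sqrt_nonneg _

theorem truncL2_sq_le_sum (hL : 1 ≤ L) (a : ℕ → ℝ) :
    truncL2 L a ^ 2 ≤ ∑ n ∈ Finset.Icc 1 (⌊L⌋₊ + 1), a n ^ 2 := by
  rw [truncL2_sq hL]
  exact Finset.sum_le_sum fun n _ => mul_le_of_le_one_left (sq_nonneg _) (truncWeight_le_one L n)

theorem truncL2_mono (hL : 1 ≤ L) {a b : ℕ → ℝ} (ha : ∀ n, 0 ≤ a n)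
    (hab : ∀ n ∈ Finset.Icc 1 (⌊L⌋₊ + 1), a n ≤ b n) : truncL2 L a ≤ truncL2 L b :=
  Real.sqrt_le_sqrt (Finset.sum_le_sum fun n hn => mul_le_mul_of_nonneg_left
    (pow_le_pow_left₀ (ha n) (hab n hn) 2) (truncWeight_nonneg hL n))

theorem truncL2_const_mul (hL : 1 ≤ L) {c : ℝ} (hc : 0 ≤ c) (a : ℕ → ℝ) :
    truncL2 L (fun n => c * a n) = c * truncL2 L a := by
  refine (sq_eq_sq₀ (truncL2_nonneg _) (mul_nonneg hc (truncL2_nonneg _))).1 ?_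
  rw [mul_pow, truncL2_sq hL, truncL2_sq hL, Finset.mul_sum]
  exact Finset.sum_congr rfl fun n _ => by ring

theorem sum_weight_mul_le (hL : 1 ≤ L) (a b : ℕ → ℝ) :
    ∑ n ∈ Finset.Icc 1 (⌊L⌋₊ + 1), truncWeight L n * (a n * b n) ≤ truncL2 L a * truncL2 L b := by
  have h := Real.sum_mul_le_sqrt_mul_sqrt (Finset.Icc 1 (⌊L⌋₊ + 1))
    (fun n => √(truncWeight L n) * a n) (fun n => √(truncWeight L n) * b n)
  have hw (n : ℕ) : √(truncWeight L n) * √(truncWeight L n) = truncWeight L n :=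
    Real.mul_self_sqrt (truncWeight_nonneg hL n)
  have h1 (a : ℕ → ℝ) (n : ℕ) : (√(truncWeight L n) * a n) ^ 2 = truncWeight L n * a n ^ 2 := by
    rw [mul_pow, sq, hw]
  simp only [h1] at h
  refine (Finset.sum_congr rfl fun n _ => ?_).trans_le h
  rw [mul_mul_mul_comm, hw]

theorem truncL2_add_le (hL : 1 ≤ L) (a b : ℕ → ℝ) :
    truncL2 L (fun n => a n + b n) ≤ truncL2 L a + truncL2 L b := by
  refine le_of_sq_le_sq ?_ (add_nonneg (truncL2_nonneg _) (truncL2_nonneg _))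
  rw [add_sq, truncL2_sq hL, truncL2_sq hL, truncL2_sq hL]
  have h := sum_weight_mul_le hL a b
  have h1 : ∑ n ∈ Finset.Icc 1 (⌊L⌋₊ + 1), truncWeight L n * (a n + b n) ^ 2 =
      ∑ n ∈ Finset.Icc 1 (⌊L⌋₊ + 1), truncWeight L n * a n ^ 2 +
      2 * ∑ n ∈ Finset.Icc 1 (⌊L⌋₊ + 1), truncWeight L n * (a n * b n) +
      ∑ n ∈ Finset.Icc 1 (⌊L⌋₊ + 1), truncWeight L n * b n ^ 2 := by
    rw [Finset.mul_sum, ← Finset.sum_add_distrib, ← Finset.sum_add_distrib]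
    exact Finset.sum_congr rfl fun n _ => by ring
  rw [h1]
  linarith

/-- Sites up to ⌊L⌋ carry full weight, so the unweighted sum is part of the weighted one, to which
Cauchy–Schwarz applies. -/
theorem sum_Icc_mul_le (hL : 1 ≤ L) {a b : ℕ → ℝ} (ha : ∀ n, 0 ≤ a n) (hb : ∀ n, 0 ≤ b n) {n : ℕ}
    (hn : n ≤ ⌊L⌋₊) : ∑ m ∈ Finset.Icc 1 n, a m * b m ≤ truncL2 L a * truncL2 L b := by
  refine le_trans ?_ (sum_weight_mul_le hL a b)
  calc _ = ∑ m ∈ Finset.Icc 1 n, truncWeight L m * (a m * b m) := by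
        refine Finset.sum_congr rfl fun m hm => ?_
        rw [truncWeight, if_pos ((Finset.mem_Icc.1 hm).2.trans hn), one_mul]
    _ ≤ _ := Finset.sum_le_sum_of_subset_of_nonneg (Finset.Icc_subset_Icc_right (by omega))
        fun m _ _ => mul_nonneg (truncWeight_nonneg hL m) (mul_nonneg (ha m) (hb m))

theorem le_truncL2 (hL : 1 ≤ L) (a : ℕ → ℝ) : a 1 ≤ truncL2 L a := by
  refine le_of_sq_le_sq ?_ (truncL2_nonneg _)
  rw [truncL2_sq hL]
  have h1 : 1 ≤ ⌊L⌋₊ := Nat.le_floor (by simpa using hL)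
  have h := Finset.single_le_sum (s := Finset.Icc 1 (⌊L⌋₊ + 1))
    (f := fun n => truncWeight L n * a n ^ 2)
    (fun n _ => mul_nonneg (truncWeight_nonneg hL n) (sq_nonneg _))
    (Finset.mem_Icc.2 ⟨le_rfl, by omega⟩ : 1 ∈ Finset.Icc 1 (⌊L⌋₊ + 1))
  rwa [truncWeight, if_pos h1, one_mul] at h

end truncL2

/-! ### Comparison of solutions at z and at x, and elimination of the auxiliary norm. -/

theorem frobenius_norm_smul (c : ℂ) (A : Matrix (Fin l) (Fin l) ℂ) : ‖c • A‖ = ‖c‖ * ‖A‖ := by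
  let _ : NormedSpace ℂ (Matrix (Fin l) (Fin l) ℂ) := Matrix.frobeniusNormedSpace
  exact norm_smul c A

theorem frobenius_mul_le (A B : Matrix (Fin l) (Fin l) ℂ) : ‖A * B‖ ≤ ‖A‖ * ‖B‖ :=
  Matrix.frobenius_norm_mul A B

/-- The comparison of the Weyl solution with the combination of solutions at real energy having the
same initial values. -/
theorem truncL2_initial_combination_le {D V : ℕ → Matrix (Fin l) (Fin l) ℝ} (hD : ∀ n, IsUnit (D n))
    (hDs : ∀ n, (D n).IsSymm) (hVs : ∀ n, (V n).IsSymm) {x y L : ℝ} (hy : 0 < y)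
    (hL : IsTruncationLength D V x y L) {F : ℕ → Matrix (Fin l) (Fin l) ℂ}
    (hF : ∀ n, toComplex (D n) * F n + toComplex (D (n + 1)) * F (n + 2)
        + toComplex (V (n + 1)) * F (n + 1) = ((x : ℂ) + y * Complex.I) • F (n + 1)) :
    truncL2 L (fun n => ‖psi D V x n * F 0 + phi D V x n * F 1‖) ≤
      2 * truncL2 L fun n => ‖F n‖ := by
  obtain ⟨hL1, hLeq⟩ := hL
  rw [truncNorm_eq_truncL2, truncNorm_eq_truncL2] at hLeq
  set a := truncL2 L fun n => ‖psi D V x n‖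
  set b := truncL2 L fun n => ‖phi D V x n‖
  set p := truncL2 L fun n => ‖F n‖
  set d := ‖(D 0)⁻¹‖ with hd
  have hd' : ‖(toComplex (D 0))⁻¹‖ = d := by rw [← toComplex_inv (hD 0), norm_toComplex]
  have hd0 : 0 ≤ d := norm_nonneg _
  have ha0 : 0 ≤ a := truncL2_nonneg _
  have hb0 : 0 ≤ b := truncL2_nonneg _
  have hp0 : 0 ≤ p := truncL2_nonneg _
  have hint (U : ℕ → Matrix (Fin l) (Fin l) ℂ) {n : ℕ} (hn : n ≤ ⌊L⌋₊) :
      ‖((x : ℂ) + y * Complex.I - x) • ((toComplex (D 0))⁻¹ *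
        ∑ m ∈ Finset.Icc 1 n, (U m).transpose * F m)‖ ≤
        y * d * ((truncL2 L fun n => ‖U n‖) * p) := by
    rw [add_sub_cancel_left, frobenius_norm_smul, norm_mul, Complex.norm_I, Complex.norm_real,
      Real.norm_of_nonneg hy.le, mul_one, mul_assoc]
    refine mul_le_mul_of_nonneg_left ((frobenius_mul_le _ _).trans ?_) hy.le
    rw [hd']
    refine mul_le_mul_of_nonneg_left ((norm_sum_le _ _).trans (le_trans ?_
      (sum_Icc_mul_le hL1 (fun n => norm_nonneg (U n)) (fun n => norm_nonneg (F n)) hn))) hd0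
    refine Finset.sum_le_sum fun m _ => (frobenius_mul_le _ _).trans_eq ?_
    rw [Matrix.frobenius_norm_transpose]
  have hdiff (n : ℕ) (hn : n ∈ Finset.Icc 1 (⌊L⌋₊ + 1)) :
      ‖psi D V x n * F 0 + phi D V x n * F 1‖ ≤
        ‖F n‖ + (y * d * b * p * ‖psi D V x n‖ + y * d * a * p * ‖phi D V x n‖) := by
    -- The formula for site m + 1 involves sums only up to m ≤ ⌊L⌋, so even the fractionally
    -- weighted site ⌊L⌋ + 1 needs only terms of full weight.
    obtain ⟨m, rfl⟩ : ∃ m, n = m + 1 := ⟨n - 1, by have := (Finset.mem_Icc.1 hn).1; omega⟩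
    have hm : m ≤ ⌊L⌋₊ := by have := (Finset.mem_Icc.1 hn).2; omega
    have h := (variation_of_parameters (x := (x : ℂ)) hD hDs hVs hF m).2
    have h1 := hint (phi D V x) hm
    have h2 := hint (psi D V x) hm
    set P := ((x : ℂ) + y * Complex.I - x) • ((toComplex (D 0))⁻¹ *
        ∑ m ∈ Finset.Icc 1 m, (phi D V x m).transpose * F m)
    set Q := ((x : ℂ) + y * Complex.I - x) • ((toComplex (D 0))⁻¹ *
        ∑ m ∈ Finset.Icc 1 m, (psi D V x m).transpose * F m)
    have h3 : psi D V x (m + 1) * F 0 + phi D V x (m + 1) * F 1 =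
        F (m + 1) + (psi D V x (m + 1) * P - phi D V x (m + 1) * Q) := by
      rw [h, mul_sub, mul_add]
      abel
    rw [h3]
    refine (norm_add_le _ _).trans (add_le_add le_rfl ((norm_sub_le _ _).trans (add_le_add ?_ ?_)))
    · refine (frobenius_mul_le _ _).trans ((mul_le_mul_of_nonneg_left h1 (norm_nonneg _)).trans_eq ?_)
      ring
    · refine (frobenius_mul_le _ _).trans ((mul_le_mul_of_nonneg_left h2 (norm_nonneg _)).trans_eq ?_)
      ring
  have h4 := truncL2_add_le hL1 (fun n => y * d * b * p * ‖psi D V x n‖)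
    (fun n => y * d * a * p * ‖phi D V x n‖)
  rw [truncL2_const_mul hL1 (mul_nonneg (mul_nonneg (mul_nonneg hy.le hd0) hb0) hp0),
    truncL2_const_mul hL1 (mul_nonneg (mul_nonneg (mul_nonneg hy.le hd0) ha0) hp0)] at h4
  -- The defining equation 2ydab = 1 of L enters here.
  have h5 : y * d * b * p * a + y * d * a * p * b = p := by
    linear_combination p * hLeq
  calc _ ≤ _ := truncL2_mono hL1 (fun n => norm_nonneg _) hdiff
    _ ≤ _ := truncL2_add_le hL1 _ _
    _ ≤ p + (y * d * b * p * a + y * d * a * p * b) := add_le_add le_rfl h4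
    _ = 2 * p := by rw [h5]; ring

/-- Either a ≤ 2emb, or the p-term dominates and a < 4ep; squaring and using `hpq` then cancels one
factor a. The constant adds the two cases. -/
theorem lower_bound_of_comparison {a b m p c e : ℝ} (hb : 0 < b) (hm : 0 ≤ m)
    (hp : 0 ≤ p) (hc : 0 ≤ c) (he : 0 < e) (hpq : p ^ 2 ≤ c * m * a * b)
    (h : a ≤ e * (2 * p + m * b)) : 1 / (2 * e + 16 * e ^ 2 * c) * (a / b) ≤ m := by
  have key : a ≤ m * b * (2 * e + 16 * e ^ 2 * c) := by
    have h0 : 0 ≤ m * b * e ^ 2 * c := by positivity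
    have h0' : 0 ≤ m * b * e := by positivity
    by_cases h1 : a ≤ 2 * e * (m * b)
    · linarith
    have h2 : a < 4 * (e * p) := by nlinarith
    have hapos : 0 < a := by nlinarith
    have h3 : a * a ≤ a * (16 * e ^ 2 * c * (m * b)) := by
      calc a * a ≤ (4 * (e * p)) * (4 * (e * p)) := by gcongr
        _ = 16 * e ^ 2 * p ^ 2 := by ring
        _ ≤ 16 * e ^ 2 * (c * m * a * b) := by gcongr
        _ = _ := by ring
    have h4 := le_of_mul_le_mul_left h3 hapos
    linarith
  have hk : 0 < 2 * e + 16 * e ^ 2 * c := by positivity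
  rw [one_div_mul_eq_div, div_div, div_le_iff₀ (by positivity)]
  linarith

/-- The same dichotomy: either sm ≤ 2da, where a further factor s is replaced by b, or sm < 4p,
where squaring cancels one factor m. -/
theorem upper_bound_of_comparison {a b s m p c d : ℝ} (ha : 0 ≤ a) (hb : 0 < b) (hs : 0 < s)
    (hsb : s ≤ b) (hm : 0 ≤ m) (hp : 0 ≤ p) (hc : 0 ≤ c) (hd : 0 ≤ d)
    (hpq : p ^ 2 ≤ c * m * a * b) (h : s * m ≤ 2 * p + d * a) :
    m ≤ (2 * d + 16 * c) * (a / b) * (b ^ 2 / s ^ 2) := by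
  have key : m * s ^ 2 ≤ (2 * d + 16 * c) * (a * b) := by
    have h0 : 0 ≤ c * (a * b) := by positivity
    have h0' : 0 ≤ d * (a * b) := by positivity
    by_cases h1 : s * m ≤ 2 * (d * a)
    · have h2 : s * (s * m) ≤ b * (2 * (d * a)) := by gcongr
      nlinarith
    have h2 : s * m < 4 * p := by linarith
    have hmpos : 0 < m := by
      rcases hm.lt_or_eq with h | h
      · exact h
      · rw [← h, mul_zero] at h1
        exact absurd (by positivity) h1
    have h3 : m * (m * s ^ 2) ≤ m * (16 * c * (a * b)) := by
      calc m * (m * s ^ 2) = (s * m) * (s * m) := by ring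
        _ ≤ (4 * p) * (4 * p) := by gcongr
        _ = 16 * p ^ 2 := by ring
        _ ≤ 16 * (c * m * a * b) := by gcongr
        _ = _ := by ring
    have h4 := le_of_mul_le_mul_left h3 hmpos
    linarith
  have h5 : (2 * d + 16 * c) * (a / b) * (b ^ 2 / s ^ 2) = (2 * d + 16 * c) * (a * b) / s ^ 2 := by
    field_simp
  rw [h5, le_div_iff₀ (by positivity)]
  exact key

/-! ### Existence of the truncation length. -/

/-- At the right endpoint the floor jumps, but the partial weight of site N + 1 has just reached 1
and the next site enters with weight 0. This gives continuity on closed unit intervals. -/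
theorem truncNorm_eq_of_mem_Icc (B : ℕ → Matrix (Fin l) (Fin l) ℂ) (N : ℕ) {L : ℝ}
    (hL : L ∈ Set.Icc (N : ℝ) (N + 1)) :
    truncNorm B L = √(∑ n ∈ Finset.Icc 1 N, ‖B n‖ ^ 2 + (L - N) * ‖B (N + 1)‖ ^ 2) := by
  have h0 : 0 ≤ L := (Nat.cast_nonneg N).trans hL.1
  rcases hL.2.lt_or_eq with h | h
  · have hf : ⌊L⌋₊ = N := (Nat.floor_eq_iff h0).2 ⟨hL.1, h⟩
    rw [truncNorm, hf]
  · have hf : ⌊L⌋₊ = N + 1 := by rw [h]; exact_mod_cast Nat.floor_natCast (N + 1)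
    rw [truncNorm, hf, h, Finset.sum_Icc_succ_top (Nat.le_add_left 1 N)]
    push_cast
    congr 1
    ring

theorem continuousOn_truncNorm (B : ℕ → Matrix (Fin l) (Fin l) ℂ) (N : ℕ) :
    ContinuousOn (truncNorm B) (Set.Icc (N : ℝ) (N + 1)) := by
  have hc : Continuous fun L : ℝ =>
      √(∑ n ∈ Finset.Icc 1 N, ‖B n‖ ^ 2 + (L - N) * ‖B (N + 1)‖ ^ 2) := by fun_prop
  exact hc.continuousOn.congr fun L hL => truncNorm_eq_of_mem_Icc B N hL

theorem truncNorm_natCast (B : ℕ → Matrix (Fin l) (Fin l) ℂ) (N : ℕ) :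
    truncNorm B N = √(∑ n ∈ Finset.Icc 1 N, ‖B n‖ ^ 2) := by
  rw [truncNorm_eq_of_mem_Icc B N ⟨le_rfl, by simp⟩]
  simp

theorem norm_le_truncNorm_natCast (B : ℕ → Matrix (Fin l) (Fin l) ℂ) {n N : ℕ} (hn : 1 ≤ n)
    (hnN : n ≤ N) : ‖B n‖ ≤ truncNorm B N := by
  rw [truncNorm_natCast]
  refine Real.le_sqrt_of_sq_le ?_
  exact Finset.single_le_sum (f := fun n => ‖B n‖ ^ 2) (fun _ _ => by positivity)
    (Finset.mem_Icc.2 ⟨hn, hnN⟩)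

theorem summable_of_truncNorm_le {B : ℕ → Matrix (Fin l) (Fin l) ℂ} {C : ℝ}
    (h : ∀ N : ℕ, 2 ≤ N → truncNorm B N ≤ C) : Summable fun n => ‖B n‖ ^ 2 := by
  rw [← summable_nat_add_iff 1]
  refine summable_of_sum_range_le (c := C ^ 2) (fun n => by positivity) fun N => ?_
  have h1 := h (N + 2) (by omega)
  rw [truncNorm_natCast, Real.sqrt_le_iff] at h1
  refine le_trans ?_ h1.2
  rw [← Finset.Ico_add_one_right_eq_Icc, Finset.sum_Ico_eq_sum_range, Nat.add_sub_cancel]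
  simp only [add_comm 1]
  exact Finset.sum_le_sum_of_subset_of_nonneg (by simp) fun _ _ _ => by positivity

theorem norm_col_le (A : Matrix (Fin l) (Fin l) ℂ) (k : Fin l) :
    ‖WithLp.toLp 2 (A.col k)‖ ≤ ‖A‖ := by
  refine le_of_sq_le_sq ?_ (norm_nonneg A)
  rw [frobenius_norm_sq_eq_sum_col]
  exact Finset.single_le_sum (f := fun k => ‖WithLp.toLp 2 (A.col k)‖ ^ 2)
    (fun _ _ => by positivity) (Finset.mem_univ k)

section

variable {D V : ℕ → Matrix (Fin l) (Fin l) ℝ} {x : ℂ}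

theorem jacobi_solution_col (hD : ∀ n, IsUnit (D n)) (A B : Matrix (Fin l) (Fin l) ℂ)
    (k : Fin l) (n : ℕ) :
    jacobi D V (fun n => WithLp.toLp 2 ((solution D V x A B n).col k)) n =
      x • WithLp.toLp 2 ((solution D V x A B (n + 1)).col k) := by
  ext j
  exact congrArg (fun M : Matrix (Fin l) (Fin l) ℂ => M j k) (solution_eq D V hD x A B n)

theorem memMaxDomain_solution_col (hD : ∀ n, IsUnit (D n)) {A B : Matrix (Fin l) (Fin l) ℂ}
    (h : Summable fun n => ‖solution D V x A B n‖ ^ 2) (k : Fin l) :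
    MemMaxDomain D V fun n => WithLp.toLp 2 ((solution D V x A B n).col k) := by
  have hu : Summable fun n => ‖WithLp.toLp 2 ((solution D V x A B n).col k)‖ ^ 2 :=
    h.of_nonneg_of_le (fun _ => by positivity)
      fun n => pow_le_pow_left₀ (norm_nonneg _) (norm_col_le _ k) 2
  refine ⟨memℓp_gen (by simpa using hu), memℓp_gen ?_⟩
  have hs := ((summable_nat_add_iff 1).2 hu).mul_left (‖x‖ ^ 2)
  simpa [jacobi_solution_col hD, norm_smul, mul_pow] using hs

-- Symmetry of D_n and V_n makes the transposed recurrence cancel against the original. Transposes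
-- rather than adjoints appear, matching the bilinear boundary form.
open Matrix in
theorem wronskian_eq (hD : ∀ n, IsUnit (D n)) (hDs : ∀ n, (D n).IsSymm)
    (hVs : ∀ n, (V n).IsSymm) (n : ℕ) :
    (psi D V x n)ᵀ * (toComplex (D n) * phi D V x (n + 1)) -
      (psi D V x (n + 1))ᵀ * (toComplex (D n) * phi D V x n) = toComplex (D 0) := by
  induction n with
  | zero => simp [psi, phi, solution]
  | succ n ih =>
    have h1 : toComplex (D (n + 1)) * phi D V x (n + 2) = _ := solution_add_two hD 0 1 n
    have h2 : toComplex (D (n + 1)) * psi D V x (n + 2) = _ := solution_add_two hD 1 0 n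
    have h3 := congrArg Matrix.transpose h2
    rw [Matrix.transpose_mul, toComplex_transpose (hDs _), Matrix.transpose_sub,
      Matrix.transpose_mul, Matrix.transpose_mul, Matrix.transpose_sub, Matrix.transpose_smul,
      Matrix.transpose_one, toComplex_transpose (hVs _), toComplex_transpose (hDs _)] at h3
    rw [h1, ← mul_assoc (psi D V x (n + 2))ᵀ, h3, ← ih]
    simp only [phi, psi, mul_sub, sub_mul, mul_assoc]
    abel

theorem not_summable_psi_phi (hl : 1 ≤ l) (hD : ∀ n, IsUnit (D n)) (hDs : ∀ n, (D n).IsSymm)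
    (hVs : ∀ n, (V n).IsSymm) (hB : BoundaryFormVanishes D V)
    (hpsi : Summable fun n => ‖psi D V x n‖ ^ 2) : ¬ Summable fun n => ‖phi D V x n‖ ^ 2 := by
  intro hphi
  have h0 : toComplex (D 0) = 0 := by
    ext j k
    have h := hB _ _ (memMaxDomain_solution_col hD hphi k) (memMaxDomain_solution_col hD hpsi j)
    refine tendsto_nhds_unique (tendsto_const_nhds.congr fun n => ?_) h
    have hw := congrArg (fun M : Matrix (Fin l) (Fin l) ℂ => M j k)
      (wronskian_eq (x := x) hD hDs hVs n)
    exact hw.symm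
  have h1 := toComplex_mul_inv (hD 0)
  rw [h0, zero_mul] at h1
  have h2 := congrArg (fun M : Matrix (Fin l) (Fin l) ℂ => M ⟨0, hl⟩ ⟨0, hl⟩) h1
  simp at h2

theorem psi_two_ne_zero (hl : 1 ≤ l) (hD : ∀ n, IsUnit (D n)) : psi D V x 2 ≠ 0 := by
  intro h
  have h1 := solution_add_two (V := V) (x := x) hD 1 0 0
  change toComplex (D 1) * psi D V x 2 = _ at h1
  rw [h] at h1
  simp only [solution, mul_zero, zero_sub, mul_one, zero_eq_neg] at h1
  have h2 := toComplex_mul_inv (hD 0)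
  rw [h1, zero_mul] at h2
  have h3 := congrArg (fun M : Matrix (Fin l) (Fin l) ℂ => M ⟨0, hl⟩ ⟨0, hl⟩) h2
  simp at h3

end

/-- If the product stayed below 1 at all integers, the lower bounds coming from φ_1 = I and ψ_2 ≠ 0
would bound both factors, making both solutions square summable. The intermediate value theorem then
applies on the unit interval ending at the first integer where 1 is reached. -/
theorem exists_mul_truncNorm_mul_truncNorm_eq_one {D V : ℕ → Matrix (Fin l) (Fin l) ℝ} (hl : 1 ≤ l)
    (hD : ∀ n, IsUnit (D n)) (hDs : ∀ n, (D n).IsSymm) (hVs : ∀ n, (V n).IsSymm)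
    (hB : BoundaryFormVanishes D V) (x : ℂ) {c : ℝ} (hc0 : 0 < c) :
    ∃ L : ℝ, 1 ≤ L ∧ c * truncNorm (psi D V x) L * truncNorm (phi D V x) L = 1 := by
  let f : ℝ → ℝ := fun L => c * truncNorm (psi D V x) L * truncNorm (phi D V x) L
  have hnn (B : ℕ → Matrix (Fin l) (Fin l) ℂ) (L : ℝ) : 0 ≤ truncNorm B L := Real.sqrt_nonneg _
  have hf1 : f (1 : ℕ) < 1 := by
    have : truncNorm (psi D V x) (1 : ℕ) = 0 := by
      rw [truncNorm_natCast]
      simp [psi, solution]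
    simp only [f, this, mul_zero, zero_mul, zero_lt_one]
  have hex : ∃ N : ℕ, 1 ≤ N ∧ 1 ≤ f N := by
    by_contra! hlt
    have hphi1 (N : ℕ) (hN : 1 ≤ N) : 1 ≤ truncNorm (phi D V x) N := by
      have h1 : phi D V x 1 = 1 := rfl
      have h := norm_le_truncNorm_natCast (phi D V x) (le_refl 1) hN
      rw [h1] at h
      exact (one_le_norm_one hl).trans h
    have hpsi2 : 0 < ‖psi D V x 2‖ := norm_pos_iff.2 (psi_two_ne_zero hl hD)
    refine not_summable_psi_phi (x := x) hl hD hDs hVs hB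
      (summable_of_truncNorm_le (C := 1 / c) fun N hN => ?_)
      (summable_of_truncNorm_le (C := 1 / (c * ‖psi D V x 2‖)) fun N hN => ?_)
    · rw [le_div_iff₀ hc0]
      have h1 := hlt N (by omega)
      have h2 := hphi1 N (by omega)
      have h3 := mul_nonneg hc0.le (hnn (psi D V x) N)
      have h4 := le_mul_of_one_le_right h3 h2
      linarith
    · rw [le_div_iff₀ (by positivity)]
      have h1 := hlt N (by omega)
      have h2 := norm_le_truncNorm_natCast (psi D V x) one_le_two hN
      have h3 := mul_le_mul_of_nonneg_right (mul_le_mul_of_nonneg_left h2 hc0.le)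
        (hnn (phi D V x) N)
      linarith
  classical
  obtain ⟨hN1, hN2⟩ := Nat.find_spec hex
  set N := Nat.find hex with hN
  have hN3 : N ≠ 1 := fun h => by
    rw [h] at hN2
    exact absurd hN2 (not_le.2 hf1)
  obtain ⟨M, hM⟩ : ∃ M, N = M + 1 := ⟨N - 1, by omega⟩
  have hfM : f M < 1 := by
    by_contra! h
    exact Nat.find_min hex (m := M) (by omega) ⟨by omega, h⟩
  have hcont : ContinuousOn f (Set.Icc (M : ℝ) (M + 1)) :=
    (continuousOn_const.mul (continuousOn_truncNorm _ M)).mul (continuousOn_truncNorm _ M)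
  rw [hM] at hN2
  obtain ⟨L, hL, hfL⟩ := intermediate_value_Icc (by simp) hcont
    (⟨hfM.le, by exact_mod_cast hN2⟩ : (1 : ℝ) ∈ Set.Icc (f M) (f (M + 1)))
  have hM1 : (1 : ℝ) ≤ M := by exact_mod_cast (by omega : 1 ≤ M)
  exact ⟨L, hM1.trans hL.1, hfL⟩

/-! ### Positivity of the denominators and the final estimates. -/

theorem truncNorm_phi_pos (hl : 1 ≤ l) (D V : ℕ → Matrix (Fin l) (Fin l) ℝ) (x : ℂ) {L : ℝ}
    (hL : 1 ≤ L) : 0 < truncNorm (phi D V x) L := by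
  rw [truncNorm_eq_truncL2]
  exact (zero_lt_one.trans_le (one_le_norm_one hl)).trans_le
    (le_truncL2 hL fun n => ‖phi D V x n‖)

theorem truncSingularValue_phi_pos (hl : 1 ≤ l) (D V : ℕ → Matrix (Fin l) (Fin l) ℝ) (x : ℂ)
    {L : ℝ} (hL : 1 ≤ L) : 0 < truncSingularValue l (phi D V x) L := by
  rw [truncSingularValue_eq_truncL2]
  exact (singularValue_one_pos hl).trans_le (le_truncL2 hL fun n => singularValue l (phi D V x n))

/-- The two inequalities between truncated norms which control the Weyl–Titchmarsh matrix. -/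
theorem weylM_comparison {D V : ℕ → Matrix (Fin l) (Fin l) ℝ} (hl : 1 ≤ l)
    (hD : ∀ n, IsUnit (D n)) (hDs : ∀ n, (D n).IsSymm) (hVs : ∀ n, (V n).IsSymm) {x y L : ℝ}
    (hy : 0 < y) (hL : IsTruncationLength D V x y L) {E : ResolutionOfIdentity (HalfLine l)}
    (hE : E.IsResolutionOf (dirichletOperator D V)) :
    ∃ p : ℝ, 0 ≤ p ∧
      p ^ 2 ≤ 2 * ‖(D 0)⁻¹‖ * l * ‖weylM E (x + y * Complex.I)‖ *
        truncNorm (psi D V x) L * truncNorm (phi D V x) L ∧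
      truncNorm (psi D V x) L ≤ ‖D 0‖ *
        (2 * p + ‖weylM E (x + y * Complex.I)‖ * truncNorm (phi D V x) L) ∧
      truncSingularValue l (phi D V x) L * ‖weylM E (x + y * Complex.I)‖ ≤
        2 * p + ‖(D 0)⁻¹‖ * truncNorm (psi D V x) L := by
  have hz : ((x : ℂ) + y * Complex.I).im = y := by simp
  obtain ⟨F, hF0, hF1, hF, hsum⟩ := exists_weyl_solution (hD 0) hE
    (z := (x : ℂ) + y * Complex.I) (by rwa [hz])
  rw [hz] at hsum
  have hf := truncL2_initial_combination_le hD hDs hVs hy hL hF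
  obtain ⟨hL1, hLeq⟩ := hL
  have hd : ‖(toComplex (D 0))⁻¹‖ = ‖(D 0)⁻¹‖ := by rw [← toComplex_inv (hD 0), norm_toComplex]
  have hp0 := truncL2_nonneg (L := L) fun n => ‖F n‖
  have hp2 := (mul_le_mul_of_nonneg_left (truncL2_sq_le_sum hL1 fun n => ‖F n‖) hy.le).trans
    (hsum _)
  rw [hF0, hF1] at hf
  rw [truncNorm_eq_truncL2, truncNorm_eq_truncL2] at hLeq ⊢
  rw [truncSingularValue_eq_truncL2]
  have ha0 := truncL2_nonneg (L := L) fun n => ‖psi D V x n‖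
  have hb0 := truncL2_nonneg (L := L) fun n => ‖phi D V x n‖
  refine ⟨_, hp0, ?_, ?_, ?_⟩
  · generalize truncL2 L (fun n => ‖F n‖) = p at hp2
    generalize truncL2 L (fun n => ‖psi D V x n‖) = a at hLeq ha0 ⊢
    generalize truncL2 L (fun n => ‖phi D V x n‖) = b at hLeq hb0 ⊢
    have h1 : 0 ≤ 2 * ‖(D 0)⁻¹‖ * a * b := by positivity
    -- By the choice of L, 1/y = 2‖D_0⁻¹‖ab, which removes y from the estimate.
    calc p ^ 2 = (2 * ‖(D 0)⁻¹‖ * a * b) * (y * p ^ 2) := by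
          linear_combination (-(p ^ 2)) * hLeq
      _ ≤ (2 * ‖(D 0)⁻¹‖ * a * b) * (l * ‖weylM E (x + y * Complex.I)‖) := by gcongr
      _ = _ := by ring
  · have h1 : truncL2 L (fun n => ‖psi D V x n‖) ≤
        ‖D 0‖ * truncL2 L (fun n => ‖psi D V x n * (toComplex (D 0))⁻¹‖) := by
      rw [← truncL2_const_mul hL1 (norm_nonneg _)]
      refine truncL2_mono hL1 (fun _ => norm_nonneg _) fun n _ => ?_
      have h2 := frobenius_mul_le (psi D V x n * (toComplex (D 0))⁻¹) (toComplex (D 0))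
      rwa [mul_assoc, toComplex_inv_mul (hD 0), mul_one, norm_toComplex, mul_comm] at h2
    refine h1.trans (mul_le_mul_of_nonneg_left ?_ (norm_nonneg _))
    rw [← truncL2_const_mul hL1 (norm_nonneg _)]
    refine le_trans (truncL2_mono hL1 (fun _ => norm_nonneg _) fun n _ => ?_)
      ((truncL2_add_le hL1 _ _).trans (add_le_add hf le_rfl))
    have h3 : psi D V x n * (toComplex (D 0))⁻¹ =
        phi D V x n * weylM E (x + y * Complex.I) - (psi D V x n * -(toComplex (D 0))⁻¹ +
          phi D V x n * weylM E (x + y * Complex.I)) := by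
      rw [mul_neg]
      abel
    refine (congrArg norm h3).trans_le ((norm_sub_le _ _).trans ?_)
    rw [add_comm, mul_comm ‖weylM E _‖]
    exact add_le_add le_rfl (frobenius_mul_le _ _)
  · rw [mul_comm, ← truncL2_const_mul hL1 (norm_nonneg _), ← truncL2_const_mul hL1 (norm_nonneg _)]
    refine le_trans (truncL2_mono hL1 (fun _ => mul_nonneg (norm_nonneg _)
      (singularValue_nonneg _ _)) fun n _ => ?_)
      ((truncL2_add_le hL1 _ _).trans (add_le_add hf le_rfl))
    rw [mul_comm]
    refine (singularValue_mul_norm_le hl _ _).trans ?_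
    have h3 : phi D V x n * weylM E (x + y * Complex.I) = (psi D V x n * -(toComplex (D 0))⁻¹ +
          phi D V x n * weylM E (x + y * Complex.I)) + psi D V x n * (toComplex (D 0))⁻¹ := by
      rw [mul_neg]
      abel
    refine (congrArg norm h3).trans_le ((norm_add_le _ _).trans (add_le_add le_rfl ?_))
    rw [← hd, mul_comm]
    exact frobenius_mul_le _ _

end MatrixJacobi

open MatrixJacobi
theorem theorem1 (l : ℕ) (hl : 1 ≤ l) (D₀ : Matrix (Fin l) (Fin l) ℝ) (hD₀ : D₀.IsSymm)
    (hD₀' : IsUnit D₀) :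
    ∃ k₁ k₂ : ℝ, 0 < k₁ ∧ 0 < k₂ ∧
      ∀ D V : ℕ → Matrix (Fin l) (Fin l) ℝ,
        D 0 = D₀ → (∀ n, (D n).IsSymm) → (∀ n, IsUnit (D n)) → (∀ n, (V n).IsSymm) →
        BoundaryFormVanishes D V →
        ∀ x y : ℝ, 0 < y →
          (∃ L : ℝ, IsTruncationLength D V x y L) ∧
          ∀ L : ℝ, IsTruncationLength D V x y L →
            truncNorm (phi D V x) L ≠ 0 ∧ truncSingularValue l (phi D V x) L ≠ 0 ∧
            ∀ E : ResolutionOfIdentity (HalfLine l), E.IsResolutionOf (dirichletOperator D V) →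
              k₁ * (truncNorm (psi D V x) L / truncNorm (phi D V x) L)
                ≤ ‖weylM E (x + y * Complex.I)‖ ∧
              ‖weylM E (x + y * Complex.I)‖
                ≤ k₂ * (truncNorm (psi D V x) L / truncNorm (phi D V x) L)
                  * (truncNorm (phi D V x) L ^ 2
                    / truncSingularValue l (phi D V x) L ^ 2) := by
  have : Nonempty (Fin l) := ⟨⟨0, hl⟩⟩
  have he : 0 < ‖D₀‖ := norm_pos_iff.2 hD₀'.ne_zero
  have hd : 0 < ‖D₀⁻¹‖ := norm_pos_iff.2 ((Matrix.isUnit_nonsing_inv_iff).2 hD₀').ne_zero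
  -- These are the constants of the two elimination lemmas with e = ‖D₀‖, d = ‖D₀⁻¹‖ and c =
  -- 2‖D₀⁻¹‖l.
  refine ⟨1 / (2 * ‖D₀‖ + 16 * ‖D₀‖ ^ 2 * (2 * ‖D₀⁻¹‖ * l)), 2 * ‖D₀⁻¹‖ + 16 * (2 * ‖D₀⁻¹‖ * l),
    by positivity, by positivity, ?_⟩
  rintro D V rfl hDs hD hVs hB x y hy
  refine ⟨exists_mul_truncNorm_mul_truncNorm_eq_one hl hD hDs hVs hB x (by positivity), fun L hL => ?_⟩
  have hb := truncNorm_phi_pos hl D V x hL.1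
  have hs := truncSingularValue_phi_pos hl D V x hL.1
  refine ⟨hb.ne', hs.ne', fun E hE => ?_⟩
  obtain ⟨p, hp, hpq, h1, h2⟩ := weylM_comparison hl hD hDs hVs hy hL hE
  have ha : 0 ≤ truncNorm (psi D V x) L := Real.sqrt_nonneg _
  have hsb : truncSingularValue l (phi D V x) L ≤ truncNorm (phi D V x) L := by
    rw [truncSingularValue_eq_truncL2, truncNorm_eq_truncL2]
    exact truncL2_mono hL.1 (fun _ => singularValue_nonneg _ _)
      fun n _ => singularValue_le_norm hl _
  exact ⟨lower_bound_of_comparison hb (norm_nonneg _) hp (by positivity) he hpq h1,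
    upper_bound_of_comparison ha hb hs hsb (norm_nonneg _) hp (by positivity) hd.le hpq h2⟩
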